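/- **Model.** Parameters: intensities $\lambda_B,\lambda_E\ge 0$; powers $P_t,N_0>0$; threshold $T_e>0$; power fraction $0<\phi\le 1$; array gains $M_s,M_a>0$; beam width $0\le\theta_b\le 180$ (degrees), with $\mathrm{Pr}_x(M_s)=\theta_b/180$ and $\mathrm{Pr}_x(M_a)=(180-\theta_b)/180$; blockage parameters $0\le C\le 1$ and $D>0$; and, for $j\in\{L,N\}$ (line-of-sight, non-line-of-sight), positive integers $N_j$, intercepts $C_j>0$ and path loss exponents $\alpha_L>0$, $\alpha_N>2$. Let $\Phi_A$ (base stations whose artificial noise is received) and $\Phi_Z$ (eavesdroppers in the intended sector) be independent homogeneous Poisson point processes on $\mathbb{R}^2$ of intensities $\lambda_B\mathrm{Pr}_x(M_a)$ and $\lambda_E\mathrm{Pr}_x(M_s)$, and let the serving base station be at $x^*\in\mathbb{R}^2$. Independently for each link from $y$ to $z$, the link is line-of-sight with probability $C$ if $\|y-z\|\le D$ and with probability $0$ otherwise; a link of state $j$ has path gain $L(y,z)=C_j\|y-z\|^{-\alpha_j}$ and fading power $g_{yz}\sim\mathrm{gamma}(N_j,1)$ (shape $N_j$, scale $1$). Put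 $$\mathrm{SINR}_z=\frac{\phi P_tM_sL(x^*,z)g_{x^*z}}{I_{A_z}+N_0},\qquad I_{A_z}=\sum_{y\in\Phi_A}(1-\phi)P_tM_a\,g_{yz}L(y,z),$$ and define the secrecy probability for non-colluding eavesdroppers as $$p_{sec}=\mathbb{E}_{\Phi_Z,\Phi_A}\Big[\prod_{z\in\Phi_Z}\Pr\big(\mathrm{SINR}_z\le T_e\,\big|\,\Phi_A\big)\Big].$$ **Theorem 7.** The integrals below converge, and $$p_{sec}\ \ge\ \exp\Big(-2\pi C\lambda_E\mathrm{Pr}_x(M_s)\int_0^D\Omega_L(r)\,r\,dr-2\pi(1-C)\lambda_E\mathrm{Pr}_x(M_s)\int_0^D\Omega_N(r)\,r\,dr\Big)\exp\Big(-2\pi\lambda_E\mathrm{Pr}_x(M_s)\int_D^\infty\Omega_N(r)\,r\,dr\Big),$$ where, with $a_j=(N_j!)^{-1/N_j}$, $$\Omega_j(r)=\sum_{n=1}^{N_j}(-1)^{n+1}\binom{N_j}{n}\exp\Big(-\frac{na_jT_er^{\alpha_j}N_0}{\phi P_tM_sC_j}\Big)\exp\Big(\Psi\Big(\frac{(1-\phi)na_jT_er^{\alpha_j}}{\phi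 M_sC_j}\Big)\Big),$$ and, with $q_L=C$, $q_N=1-C$, $\kappa_j=D^{\alpha_j}/(M_aC_j)$, $\Psi(0)=0$ and for $s>0$, $$\Psi(s)=-s\Big(2\pi\lambda_B\sum_{j\in\{L,N\}}q_j\mathrm{Pr}_x(M_a)\frac{(M_aC_j)^{2/\alpha_j}}{\alpha_j}\sum_{m=0}^{N_j-1}\frac{\kappa_j^{m+2/\alpha_j}}{(m+\frac2{\alpha_j})(s+\kappa_j)^{m+1}}\,{}_2F_1\Big(1,m+1;m+\tfrac2{\alpha_j}+1;\frac{\kappa_j}{\kappa_j+s}\Big)$$ $$\qquad+2\pi\lambda_B\mathrm{Pr}_x(M_a)\frac{(M_aC_N)^{2/\alpha_N}}{\alpha_N}\sum_{m=0}^{N_N-1}\frac{\kappa_N^{m+2/\alpha_N}}{(1-\frac2{\alpha_N})(s+\kappa_N)^{m+1}}\,{}_2F_1\Big(1,m+1;2-\tfrac2{\alpha_N};\frac{s}{s+\kappa_N}\Big)\Big).$$ -/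

import Mathlib

open MeasureTheory ProbabilityTheory Set
open scoped ENNReal

namespace MmWave

/-! ### Poisson point processes -/

/-- The Euclidean plane in which base stations and eavesdroppers live. -/
abbrev Plane : Type := EuclideanSpace ℝ (Fin 2)

/-- A point process on `E` over the sample space `Ω`: a random number `count` (possibly infinite)
of points, listed as the measurable random elements `point i` with `i < count`.
The values `point i` with `count ≤ i` do not belong to the process. -/
structure PointProcess (Ω E : Type*) [MeasurableSpace Ω] [MeasurableSpace E] where
  count : Ω → ℕ∞
  point : ℕ → Ω → E
  measurable_count : Measurable count
  measurable_point : ∀ i, Measurable (point i)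

/-- The number of points of the process that lie in `B`. -/
noncomputable def PointProcess.numberIn {Ω E : Type*} [MeasurableSpace Ω] [MeasurableSpace E]
    (Φ : PointProcess Ω E) (B : Set E) (ω : Ω) : ℕ∞ :=
  {i : ℕ | (i : ℕ∞) < Φ.count ω ∧ Φ.point i ω ∈ B}.encard

/-- The process together with its listing, as one random element. -/
def PointProcess.listing {Ω E : Type*} [MeasurableSpace Ω] [MeasurableSpace E]
    (Φ : PointProcess Ω E) (ω : Ω) : ℕ∞ × (ℕ → E) :=
  (Φ.count ω, fun i => Φ.point i ω)

/-- `Φ` is a Poisson point process with intensity measure `Λ` under the probability `P`: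
the number of points in a measurable set `B` with `Λ B < ∞` is Poisson distributed
with mean `Λ B`, and the numbers of points in disjoint measurable sets are independent. -/
structure PointProcess.IsPoisson {Ω E : Type*} [MeasurableSpace Ω] [MeasurableSpace E]
    (Φ : PointProcess Ω E) (Λ : Measure E) (P : Measure Ω) : Prop where
  poisson : ∀ B : Set E, MeasurableSet B → Λ B < ∞ → ∀ k : ℕ,
    P {ω | Φ.numberIn B ω = k} =
      ENNReal.ofReal (Real.exp (-(Λ B).toReal) * (Λ B).toReal ^ k / (k.factorial : ℝ))
  indep : ∀ (n : ℕ) (B : Fin n → Set E), (∀ i, MeasurableSet (B i)) →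
    Pairwise (fun i j => Disjoint (B i) (B j)) →
    iIndepFun (fun i => Φ.numberIn (B i)) P

/-! ### The network with artificial noise -/

/-- A link is line-of-sight or non-line-of-sight. -/
inductive LinkState where
  | LOS
  | NLOS

/-- The parameters of a millimeter wave network with artificial noise. -/
structure Network where
  /-- intensity of the base stations -/
  lamB : ℝ
  lamB_nonneg : 0 ≤ lamB
  /-- intensity of the eavesdroppers -/
  lamE : ℝ
  lamE_nonneg : 0 ≤ lamE
  /-- total transmit power of a base station -/
  Pt : ℝ
  Pt_pos : 0 < Pt
  /-- fraction of the power that carries the confidential signal -/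
  phi : ℝ
  phi_pos : 0 < phi
  phi_le_one : phi ≤ 1
  /-- main lobe gain of the confidential signal -/
  Ms : ℝ
  Ms_pos : 0 < Ms
  /-- main lobe gain of the artificial noise -/
  Ma : ℝ
  Ma_pos : 0 < Ma
  /-- beam width parameter, in degrees -/
  thetaB : ℝ
  thetaB_nonneg : 0 ≤ thetaB
  thetaB_le : thetaB ≤ 180
  /-- probability that a link of length at most `D` is line-of-sight -/
  C : ℝ
  C_nonneg : 0 ≤ C
  C_le_one : C ≤ 1
  /-- radius beyond which no link is line-of-sight -/
  D : ℝ
  D_pos : 0 < D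
  /-- Nakagami fading parameters (positive integers) -/
  shape : LinkState → ℕ+
  /-- path loss exponents -/
  alpha : LinkState → ℝ
  alpha_LOS_pos : 0 < alpha .LOS
  two_lt_alpha_NLOS : 2 < alpha .NLOS
  /-- path loss intercepts `C_L`, `C_N` -/
  intercept : LinkState → ℝ
  intercept_pos : ∀ j, 0 < intercept j
  /-- noise power -/
  N0 : ℝ
  N0_pos : 0 < N0
  /-- SINR threshold of the eavesdroppers -/
  Te : ℝ
  Te_pos : 0 < Te

namespace Network

variable (net : Network)

/-- Probability that a receiver is in the sector of the confidential signal. -/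
noncomputable def probMs : ℝ := net.thetaB / 180

/-- Probability that a receiver is in the sector of the artificial noise. -/
noncomputable def probMa : ℝ := (180 - net.thetaB) / 180

/-- Probability that a link of length `r` is line-of-sight. -/
noncomputable def qL (r : ℝ) : ℝ := if r ≤ net.D then net.C else 0

/-- Probability, inside the ball of radius `D`, of each link state. -/
def q : LinkState → ℝ
  | .LOS => net.C
  | .NLOS => 1 - net.C

/-- Path gain of a link of length `r` and given state. -/
noncomputable def pathGain (j : LinkState) (r : ℝ) : ℝ := net.intercept j * r ^ (-net.alpha j)

/-- The law `gamma(N_j, 1)` (shape `N_j`, scale `1`) of the fading power of a link of state `j`. -/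
noncomputable def fadingLaw (j : LinkState) : Measure ℝ :=
  gammaMeasure ((net.shape j : ℕ) : ℝ) 1

instance (j : LinkState) : IsProbabilityMeasure (net.fadingLaw j) :=
  isProbabilityMeasure_gammaMeasure (Nat.cast_pos.mpr (net.shape j).pos) one_pos

/-- The randomness attached to one link: a uniform variable on `[0, 1]` which decides about
blockage, and the fading powers to be used if the link is LOS and if it is NLOS. -/
abbrev LinkMark : Type := ℝ × ℝ × ℝ

/-- The law of the randomness of one link: three independent coordinates. -/
noncomputable def linkLaw : Measure LinkMark :=
  (volume.restrict (Icc (0 : ℝ) 1)).prod ((net.fadingLaw .LOS).prod (net.fadingLaw .NLOS))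

instance : IsProbabilityMeasure net.linkLaw := by
  have : IsProbabilityMeasure (volume.restrict (Icc (0 : ℝ) 1)) := ⟨by simp⟩
  unfold linkLaw
  infer_instance

/-- Channel power gain (path gain times fading) of a link of length `r`; the link is LOS
with probability `qL r` and NLOS otherwise. -/
noncomputable def linkGain (r : ℝ) (w : LinkMark) : ℝ :=
  if w.1 ≤ net.qL r then net.pathGain .LOS r * w.2.1 else net.pathGain .NLOS r * w.2.2

/-- Artificial noise power received at `z` from the base stations at the points `y i`,
`i < n`; the link from `y i` to `z` has the randomness `w i`. The value may be `∞`. -/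
noncomputable def noiseInterference (n : ℕ∞) (y : ℕ → Plane) (z : Plane) (w : ℕ → LinkMark) :
    ℝ≥0∞ :=
  ∑' i : ℕ, if (i : ℕ∞) < n then
    ENNReal.ofReal ((1 - net.phi) * net.Pt * net.Ma * net.linkGain (dist (y i) z) (w i)) else 0

/-- SINR at an eavesdropper at `z`, when the serving base station is at `x` and the link from
`x` to `z` has the randomness `w.1`. -/
noncomputable def sinr (x : Plane) (n : ℕ∞) (y : ℕ → Plane) (z : Plane)
    (w : LinkMark × (ℕ → LinkMark)) : ℝ≥0∞ :=
  ENNReal.ofReal (net.phi * net.Pt * net.Ms * net.linkGain (dist x z) w.1) /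
    (net.noiseInterference n y z w.2 + ENNReal.ofReal net.N0)

/-- Conditional probability that the SINR at `z` is at most `Te`, given the locations `y i`,
`i < n`, of the base stations that send artificial noise: all links that end in `z`
have independent blockage and fading. -/
noncomputable def probSinrLe (x : Plane) (n : ℕ∞) (y : ℕ → Plane) (z : Plane) : ℝ :=
  (net.linkLaw.prod (Measure.infinitePi fun _ : ℕ => net.linkLaw)).real
    {w | net.sinr x n y z w ≤ ENNReal.ofReal net.Te}

/-- The secrecy probability
`𝔼 [∏_{z ∈ ΦZ} Pr (SINR_z ≤ Te | ΦA)]`, the expectation being over `ΦZ` and `ΦA`.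
The factors are in `[0, 1]`, so that the product over all points always converges. -/
noncomputable def secrecyProb {Ω : Type*} [MeasurableSpace Ω] (P : Measure Ω)
    (ΦA ΦZ : PointProcess Ω Plane) (x : Plane) : ℝ :=
  ∫ ω, ∏' i : ℕ, (if (i : ℕ∞) < ΦZ.count ω then
    net.probSinrLe x (ΦA.count ω) (fun k => ΦA.point k ω) (ΦZ.point i ω) else 1) ∂P

/-! ### The bound -/

/-- `D ^ α_j / (M_a C_j)` -/
noncomputable def ratio (j : LinkState) : ℝ :=
  net.D ^ net.alpha j / (net.Ma * net.intercept j)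

/-- `(M_a C_j) ^ (2 / α_j) / α_j` -/
noncomputable def prefactor (j : LinkState) : ℝ :=
  (net.Ma * net.intercept j) ^ (2 / net.alpha j) / net.alpha j

/-- The contribution to `Ψ` of the links of state `j` and length at most `D`. -/
noncomputable def psiIn (j : LinkState) (s : ℝ) : ℝ :=
  net.probMa * net.prefactor j * ∑ m ∈ Finset.range (net.shape j : ℕ),
    net.ratio j ^ ((m : ℝ) + 2 / net.alpha j) /
        (((m : ℝ) + 2 / net.alpha j) * (s + net.ratio j) ^ (m + 1)) *
      ordinaryHypergeometric (1 : ℝ) ((m : ℝ) + 1) ((m : ℝ) + 2 / net.alpha j + 1)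
        (net.ratio j / (net.ratio j + s))

/-- The contribution to `Ψ` of the links of length more than `D` (all of them NLOS). -/
noncomputable def psiOut (s : ℝ) : ℝ :=
  net.probMa * net.prefactor .NLOS * ∑ m ∈ Finset.range (net.shape .NLOS : ℕ),
    net.ratio .NLOS ^ ((m : ℝ) + 2 / net.alpha .NLOS) /
        ((1 - 2 / net.alpha .NLOS) * (s + net.ratio .NLOS) ^ (m + 1)) *
      ordinaryHypergeometric (1 : ℝ) ((m : ℝ) + 1) (2 - 2 / net.alpha .NLOS)
        (s / (s + net.ratio .NLOS))

/-- The exponent `Ψ` of the Laplace transform of the artificial noise; `Ψ 0 = 0`. -/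
noncomputable def Psi (s : ℝ) : ℝ :=
  -s * (2 * Real.pi * net.lamB *
        (net.q .LOS * net.psiIn .LOS s + net.q .NLOS * net.psiIn .NLOS s) +
      2 * Real.pi * net.lamB * net.psiOut s)

/-- `a_j = (N_j !) ^ (-1 / N_j)` -/
noncomputable def a (j : LinkState) : ℝ :=
  ((net.shape j : ℕ).factorial : ℝ) ^ (-(1 : ℝ) / ((net.shape j : ℕ) : ℝ))

/-- The function `Ω_j`. -/
noncomputable def Omega (j : LinkState) (r : ℝ) : ℝ :=
  ∑ n ∈ Finset.Icc 1 (net.shape j : ℕ),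
    (-1 : ℝ) ^ (n + 1) * ((net.shape j : ℕ).choose n : ℝ) *
      Real.exp (-((n : ℝ) * net.a j * net.Te * r ^ net.alpha j * net.N0 /
        (net.phi * net.Pt * net.Ms * net.intercept j))) *
      Real.exp (net.Psi ((1 - net.phi) * (n : ℝ) * net.a j * net.Te * r ^ net.alpha j /
        (net.phi * net.Ms * net.intercept j)))

end Network

end MmWave

/-! Given the noise sources `ΦA`, write `p(z)` for the probability that the SINR at `z` stays below
the threshold. The eavesdroppers `ΦZ` are Poisson and independent of `ΦA`, so the Laplace
functional, applied to `-log p`, turns the expected product into `E exp (-∫ (1 - p) dΛ)`, where `Λ`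
is their intensity measure and the expectation is over `ΦA` (`secrecyProb_eq`). Jensen's inequality
and Tonelli's theorem then bound this below by `exp (-∫ E (1 - p(z)) dΛ)`, and an upper bound on `E
(1 - p(z))` for each single `z` suffices.

For a link of given state, exceeding the threshold means that a gamma variable exceeds a multiple of
interference plus noise `Y`. Alzer's inequality bounds this tail by `1 - (1 - exp (-tY)) ^ N`. Its
binomial expansion involves `Y` only through its Laplace transform at `n * t`, and averaging gives
exactly `Omega` (`lintegral_tailBound`).

That Laplace transform splits into the constant noise factor and the transform of a Poisson sum with
independent marks. The latter is the exponential of minus an integral over the plane of one minus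
the transform of a single link. In polar coordinates, split at the radius `D`, this integral has a
primitive in terms of `₂F₁(1, m + 1; b + 1; ·)`, verified through a first order differential
equation; the result is `Psi` (`Psi_eq_integral`).

Most expectations are taken in `[0, ∞]`, with `negExp` as the exponential, so that infinite
interference and infinitely many points need no separate convergence argument. -/

/-! ### The negative exponential on `[0, ∞]` and Jensen's inequality -/

/-- The function `x ↦ exp (-x)` on `[0, ∞]`, with value `0` at `∞`. -/
noncomputable def negExp (x : ℝ≥0∞) : ℝ≥0∞ := EReal.exp (-(x : EReal))

lemma negExp_ofReal {t : ℝ} (ht : 0 ≤ t) :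
    negExp (ENNReal.ofReal t) = ENNReal.ofReal (Real.exp (-t)) := by
  unfold negExp
  rw [EReal.coe_ennreal_ofReal, max_eq_left ht, ← EReal.coe_neg, EReal.exp_coe]

@[simp] lemma negExp_zero : negExp 0 = 1 := by simp [negExp]

@[simp] lemma negExp_top : negExp ∞ = 0 := by simp [negExp]

lemma continuous_negExp : Continuous negExp :=
  ENNReal.continuous_exp.comp (continuous_neg.comp continuous_coe_ennreal_ereal)

lemma measurable_negExp : Measurable negExp := continuous_negExp.measurable

lemma antitone_negExp : Antitone negExp := fun _ _ h =>
  EReal.exp_monotone (EReal.neg_le_neg_iff.mpr (EReal.coe_ennreal_le_coe_ennreal_iff.mpr h))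

lemma negExp_le_one (x : ℝ≥0∞) : negExp x ≤ 1 := by
  rw [← negExp_zero]; exact antitone_negExp (zero_le)

lemma negExp_ne_top (x : ℝ≥0∞) : negExp x ≠ ∞ := ((negExp_le_one x).trans_lt ENNReal.one_lt_top).ne

lemma negExp_add (x y : ℝ≥0∞) : negExp (x + y) = negExp x * negExp y := by
  induction x using ENNReal.recTopCoe with
  | top => simp
  | coe x =>
    induction y using ENNReal.recTopCoe with
    | top => simp
    | coe y =>
      rw [← ENNReal.ofReal_coe_nnreal, ← ENNReal.ofReal_coe_nnreal,
        ← ENNReal.ofReal_add x.coe_nonneg y.coe_nonneg, negExp_ofReal (by positivity),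
        negExp_ofReal x.coe_nonneg, negExp_ofReal y.coe_nonneg, ← ENNReal.ofReal_mul (Real.exp_nonneg _), ← Real.exp_add]
      congr 2
      ring

lemma negExp_sum {ι : Type*} (s : Finset ι) (f : ι → ℝ≥0∞) :
    negExp (∑ i ∈ s, f i) = ∏ i ∈ s, negExp (f i) := by
  classical
  induction s using Finset.induction_on with
  | empty => simp
  | insert i s hi ih => rw [Finset.sum_insert hi, Finset.prod_insert hi, negExp_add, ih]

lemma negExp_nat_mul (n : ℕ) (x : ℝ≥0∞) : negExp (n * x) = negExp x ^ n := by
  rw [← nsmul_eq_mul, ← Finset.card_range n, ← Finset.sum_const, negExp_sum, Finset.prod_const]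

/-- Sums in `[0, ∞]` always converge, so products of numbers in `[0, 1]` do too. A divergent sum
gives the product `0`. -/
lemma tendsto_prod_negExp {ι : Type*} (f : ι → ℝ≥0∞) :
    Filter.Tendsto (fun s : Finset ι => ∏ i ∈ s, negExp (f i)) Filter.atTop
      (nhds (negExp (∑' i, f i))) := by
  simp_rw [← negExp_sum]
  exact (continuous_negExp.tendsto _).comp ENNReal.summable.hasSum

/-- The function `p ↦ - log p`, an inverse of `negExp` on `[0, 1]`. -/
noncomputable def negLog (p : ℝ≥0∞) : ℝ≥0∞ := (-(ENNReal.log p)).toENNReal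

lemma negExp_negLog {p : ℝ≥0∞} (hp : p ≤ 1) : negExp (negLog p) = p := by
  have : (0 : EReal) ≤ -(ENNReal.log p) := by
    rw [EReal.le_neg, neg_zero]
    exact ENNReal.log_le_zero_iff.mpr hp
  rw [negExp, negLog, EReal.coe_toENNReal this, neg_neg, ENNReal.exp_log]

lemma measurable_negLog : Measurable negLog :=
  (continuous_neg.measurable.comp ENNReal.measurable_log).ereal_toENNReal

/-- The tangent of the convex function `negExp` lies below it. -/
lemma tangent_le_negExp {M : ℝ} (_ : 0 ≤ M) (x : ℝ≥0∞) :
    ENNReal.ofReal (Real.exp (-M) * (1 + M)) ≤ negExp x + ENNReal.ofReal (Real.exp (-M)) * x := by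
  induction x using ENNReal.recTopCoe with
  | top =>
    rw [ENNReal.mul_top (by simp [Real.exp_pos])]
    simp
  | coe x =>
    rw [← ENNReal.ofReal_coe_nnreal, negExp_ofReal x.coe_nonneg, ← ENNReal.ofReal_mul (Real.exp_nonneg _),
      ← ENNReal.ofReal_add (Real.exp_nonneg _) (by positivity)]
    apply ENNReal.ofReal_le_ofReal
    have h1 : Real.exp (-(x : ℝ)) = Real.exp (-M) * Real.exp (M - x) := by
      rw [← Real.exp_add]; congr 1; ring
    have h2 := Real.add_one_le_exp (M - (x : ℝ))
    rw [h1, ← mul_add]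
    exact mul_le_mul_of_nonneg_left (by linarith) (Real.exp_nonneg _)

/-- Jensen's inequality for `negExp`. -/
lemma negExp_le_lintegral_negExp {Ω : Type*} [MeasurableSpace Ω] (P : Measure Ω)
    [IsProbabilityMeasure P] {X : Ω → ℝ≥0∞} (hX : Measurable X) {M : ℝ} (hM : 0 ≤ M)
    (h : ∫⁻ ω, X ω ∂P ≤ ENNReal.ofReal M) :
    ENNReal.ofReal (Real.exp (-M)) ≤ ∫⁻ ω, negExp (X ω) ∂P := by
  -- Integrating the tangent at `M` suffices, although `M` only bounds the mean from above: the
  -- slope is negative, so the inequality survives. The finite term `e^{-M} M` then cancels.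
  have h1 : ENNReal.ofReal (Real.exp (-M) * (1 + M)) ≤
      ∫⁻ ω, negExp (X ω) ∂P + ENNReal.ofReal (Real.exp (-M)) * ENNReal.ofReal M := by
    calc ENNReal.ofReal (Real.exp (-M) * (1 + M))
        = ∫⁻ _, ENNReal.ofReal (Real.exp (-M) * (1 + M)) ∂P := by simp
      _ ≤ ∫⁻ ω, (negExp (X ω) + ENNReal.ofReal (Real.exp (-M)) * X ω) ∂P :=
          lintegral_mono fun ω => tangent_le_negExp hM _
      _ = ∫⁻ ω, negExp (X ω) ∂P + ENNReal.ofReal (Real.exp (-M)) * ∫⁻ ω, X ω ∂P := by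
          rw [lintegral_add_right _ (hX.const_mul _), lintegral_const_mul _ hX]
      _ ≤ _ := by gcongr
  rw [mul_add, mul_one, ENNReal.ofReal_add (Real.exp_nonneg _) (by positivity),
    ENNReal.ofReal_mul (Real.exp_nonneg _)] at h1
  exact (ENNReal.add_le_add_iff_right (ENNReal.mul_ne_top ENNReal.ofReal_ne_top
    ENNReal.ofReal_ne_top)).mp h1

/-! ### Alzer's inequality and the gamma tail -/

/-- If `f 0 = 0` and the derivative of `f` stays nonpositive once it has been negative, then `f`
is antitone from the point on where it is negative. -/
lemma antitoneOn_of_sign_pattern {f f' : ℝ → ℝ} (hc : ContinuousOn f (Ici 0))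
    (hf : ∀ x, 0 < x → HasDerivAt f (f' x) x) (h0 : f 0 = 0)
    (hs : ∀ x y, 0 < x → x ≤ y → f' x < 0 → f' y ≤ 0) {x : ℝ} (hx : 0 < x) (hfx : f x < 0) :
    AntitoneOn f (Ici x) := by
  obtain ⟨c, hc1, hc2⟩ := exists_hasDerivAt_eq_slope f f' hx (hc.mono Icc_subset_Ici_self)
    fun y hy => hf y hy.1
  have hneg : f' c < 0 := by
    rw [hc2, h0]
    exact div_neg_of_neg_of_pos (by linarith) (by linarith)
  have hsub : Ici x ⊆ Ici 0 := Ici_subset_Ici.mpr hx.le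
  refine antitoneOn_of_deriv_nonpos (convex_Ici x) (hc.mono hsub) ?_ ?_
  · intro y hy
    rw [interior_Ici] at hy
    exact (hf y (hx.trans hy)).differentiableAt.differentiableWithinAt
  · intro y hy
    rw [interior_Ici] at hy
    rw [(hf y (hx.trans hy)).deriv]
    exact hs c y hc1.1 (hc1.2.le.trans (le_of_lt hy)) hneg

/-- The sign pattern passes from the derivative to the function, so it can be lifted through several
derivatives in turn. -/
lemma nonpos_of_sign_pattern {f f' : ℝ → ℝ} (hc : ContinuousOn f (Ici 0))
    (hf : ∀ x, 0 < x → HasDerivAt f (f' x) x) (h0 : f 0 = 0)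
    (hs : ∀ x y, 0 < x → x ≤ y → f' x < 0 → f' y ≤ 0) (x y : ℝ) (hx : 0 < x) (hxy : x ≤ y)
    (hfx : f x < 0) : f y ≤ 0 :=
  (antitoneOn_of_sign_pattern hc hf h0 hs hx hfx self_mem_Ici hxy hxy).trans hfx.le

/-- A function that has become negative is antitone from there on, and so cannot return to the limit
`0`. -/
lemma nonneg_of_sign_pattern {f f' : ℝ → ℝ} (hc : ContinuousOn f (Ici 0))
    (hf : ∀ x, 0 < x → HasDerivAt f (f' x) x) (h0 : f 0 = 0)
    (hs : ∀ x y, 0 < x → x ≤ y → f' x < 0 → f' y ≤ 0)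
    (hlim : Filter.Tendsto f Filter.atTop (nhds 0)) {x : ℝ} (hx : 0 < x) : 0 ≤ f x := by
  by_contra! h
  have hanti := antitoneOn_of_sign_pattern hc hf h0 hs hx h
  have : 0 ≤ f x := le_of_tendsto hlim <| by
    filter_upwards [Filter.eventually_ge_atTop x] with y hy
    exact hanti self_mem_Ici hy hy
  linarith

/-- `a x e^{-b x} - (1 - e^{-a x})` stays nonpositive once it has been negative. -/
lemma alzer_auxiliary_sign {a b : ℝ} (ha : 0 < a) (x y : ℝ) (hx : 0 < x) (hxy : x ≤ y)
    (h : a * x * Real.exp (-(b * x)) - (1 - Real.exp (-(a * x))) < 0) :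
    a * y * Real.exp (-(b * y)) - (1 - Real.exp (-(a * y))) ≤ 0 := by
  -- This is the sign-determining factor of the derivative of the function in question. Its own
  -- derivative is antitone, so two applications of the sign pattern suffice.
  have hB : ∀ x y : ℝ, 0 < x → x ≤ y → (1 - b * x) - Real.exp (-((a - b) * x)) < 0 →
      (1 - b * y) - Real.exp (-((a - b) * y)) ≤ 0 := by
    refine nonpos_of_sign_pattern (f := fun x => (1 - b * x) - Real.exp (-((a - b) * x)))
      (f' := fun x => -b + (a - b) * Real.exp (-((a - b) * x))) (by fun_prop) ?_ (by simp) ?_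
    · intro x _
      have h1 : HasDerivAt (fun x : ℝ => -((a - b) * x)) (-(a - b)) x := by
        simpa using ((hasDerivAt_id x).const_mul (a - b)).fun_neg
      have h2 := ((hasDerivAt_id x).const_mul b).const_sub 1 |>.sub h1.exp
      refine h2.congr_deriv ?_
      ring
    · intro x y _ hxy h
      refine le_trans ?_ h.le
      gcongr 1
      have : Real.exp (-((a - b) * y)) - Real.exp (-((a - b) * x)) =
        Real.exp (-((a - b) * x)) * (Real.exp ((a - b) * (x - y)) - 1) := by
          rw [mul_sub, ← Real.exp_add]; ring_nf
      rcases le_total a b with hab | hab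
      · apply mul_le_mul_of_nonpos_left _ (by linarith)
        apply Real.exp_le_exp.mpr
        nlinarith
      · apply mul_le_mul_of_nonneg_left _ (by linarith)
        apply Real.exp_le_exp.mpr
        nlinarith
  refine nonpos_of_sign_pattern
    (f := fun x => a * x * Real.exp (-(b * x)) - (1 - Real.exp (-(a * x))))
    (f' := fun x => a * Real.exp (-(b * x)) * ((1 - b * x) - Real.exp (-((a - b) * x))))
    (by fun_prop) ?_ (by simp) ?_ x y hx hxy h
  · intro x _
    have h1 : HasDerivAt (fun x : ℝ => -(b * x)) (-b) x := by
      simpa using ((hasDerivAt_id x).const_mul b).fun_neg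
    have h2 : HasDerivAt (fun x : ℝ => -(a * x)) (-a) x := by
      simpa using ((hasDerivAt_id x).const_mul a).fun_neg
    have h3 : HasDerivAt (fun x : ℝ => a * x) a x := by
      simpa using (hasDerivAt_id x).const_mul a
    refine ((h3.mul h1.exp).sub (h2.exp.const_sub 1)).congr_deriv ?_
    have : Real.exp (-(a * x)) = Real.exp (-(b * x)) * Real.exp (-((a - b) * x)) := by
      rw [← Real.exp_add]; congr 1; ring
    rw [this]; ring
  · intro x y hx hxy h
    have h1 := hB x y hx hxy (by
      by_contra! h'
      exact absurd h (not_lt.mpr (by positivity)))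
    exact mul_nonpos_of_nonneg_of_nonpos (by positivity) h1

/-- **Alzer's inequality** for the incomplete gamma function of integer order. -/
lemma alzer_inequality (n : ℕ) {a : ℝ} (ha : 0 < a) (han : a ^ (n + 1) * (n + 1).factorial = 1)
    {F : ℝ → ℝ} (hc : ContinuousOn F (Ici 0)) (h0 : F 0 = 0)
    (hF : ∀ x, 0 < x → HasDerivAt F (x ^ n * Real.exp (-x) / n.factorial) x)
    (hlim : Filter.Tendsto F Filter.atTop (nhds 1)) {x : ℝ} (hx : 0 ≤ x) :
    (1 - Real.exp (-(a * x))) ^ (n + 1) ≤ F x := by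
  rcases hx.eq_or_lt with rfl | hx
  · simp [h0]
  have hE : ∀ x : ℝ, 0 < x → 0 < 1 - Real.exp (-(a * x)) := fun x hx => by
    have : Real.exp (-(a * x)) < 1 := Real.exp_lt_one_iff.mpr (by have := mul_pos ha hx; linarith)
    linarith
  suffices 0 ≤ F x - (1 - Real.exp (-(a * x))) ^ (n + 1) by linarith
  -- The difference vanishes at `0` and at infinity; only the sign pattern of its derivative remains
  -- to be checked.
  refine nonneg_of_sign_pattern (f := fun x => F x - (1 - Real.exp (-(a * x))) ^ (n + 1))
    (f' := fun x => x ^ n * Real.exp (-x) / n.factorial -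
      (n + 1) * (1 - Real.exp (-(a * x))) ^ n * (a * Real.exp (-(a * x))))
    (hc.sub (by fun_prop)) ?_ (by simp [h0]) ?_ ?_ hx
  · intro x hx
    have h2 : HasDerivAt (fun x : ℝ => -(a * x)) (-a) x := by
      simpa using ((hasDerivAt_id x).const_mul a).fun_neg
    refine ((hF x hx).sub ((h2.exp.const_sub 1).pow (n + 1))).congr_deriv ?_
    push_cast
    ring
  -- For shape `1` the normalisation forces `a = 1`, and the derivative is identically zero.
  · rcases Nat.eq_zero_or_pos n with rfl | hn
    · have : a = 1 := by simpa using han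
      subst this
      intro x y _ _ _
      simp
    have hn' : (0 : ℝ) < n := Nat.cast_pos.mpr hn
    -- This choice makes `e^{-x} = e^{-ax} (e^{-bx})^n`. With `a^(n+1) (n+1)! = 1`, the derivative
    -- becomes a positive factor times a difference of two `n`-th powers, whose sign is governed by
    -- `alzer_auxiliary_sign`.
    set b : ℝ := (1 - a) / n with hb
    have key : ∀ x : ℝ, x ^ n * Real.exp (-x) / n.factorial -
        (n + 1) * (1 - Real.exp (-(a * x))) ^ n * (a * Real.exp (-(a * x))) =
        (n + 1) * a * Real.exp (-(a * x)) *
          ((a * x * Real.exp (-(b * x))) ^ n - (1 - Real.exp (-(a * x))) ^ n) := by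
      intro x
      have h1 : Real.exp (-x) = Real.exp (-(a * x)) * Real.exp (-(b * x)) ^ n := by
        rw [← Real.exp_nat_mul, ← Real.exp_add, hb]
        congr 1
        field_simp
        ring
      have h2 : (n + 1 : ℝ) * a ^ (n + 1) * n.factorial = 1 := by
        have h := han
        rw [Nat.factorial_succ] at h
        push_cast at h
        linear_combination h
      have h3 : (n.factorial : ℝ) ≠ 0 := by positivity
      rw [h1]
      generalize Real.exp (-(a * x)) = E
      generalize Real.exp (-(b * x)) = G
      rw [mul_pow, mul_pow]
      field_simp
      linear_combination (-(E * x ^ n * G ^ n)) * h2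
    intro x y hx hxy h
    rw [key] at h ⊢
    have hpos : ∀ x, 0 < (n + 1 : ℝ) * a * Real.exp (-(a * x)) := fun x => by positivity
    refine mul_nonpos_of_nonneg_of_nonpos (hpos y).le ?_
    have h1 : a * x * Real.exp (-(b * x)) - (1 - Real.exp (-(a * x))) < 0 := by
      by_contra! h'
      refine absurd h (not_lt.mpr (mul_nonneg (hpos x).le ?_))
      have := pow_le_pow_left₀ (hE x hx).le (sub_nonneg.mp h') n
      linarith
    have h2 := alzer_auxiliary_sign ha x y hx hxy h1
    have hy := hx.trans_le hxy
    have := pow_le_pow_left₀ (by positivity) (sub_nonpos.mp h2) n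
    linarith
  · have h1 : Filter.Tendsto (fun x : ℝ => Real.exp (-(a * x))) Filter.atTop (nhds 0) :=
      Real.tendsto_exp_neg_atTop_nhds_zero.comp (Filter.tendsto_id.const_mul_atTop ha)
    simpa using hlim.sub ((h1.const_sub 1).pow (n + 1))

lemma gammaPDFReal_natCast_add_one (n : ℕ) {x : ℝ} (hx : 0 ≤ x) :
    gammaPDFReal ((n + 1 : ℕ) : ℝ) 1 x = x ^ n * Real.exp (-x) / n.factorial := by
  rw [gammaPDFReal, if_pos hx]
  push_cast
  rw [Real.Gamma_nat_eq_factorial]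
  simp
  ring

/-- Tail bound for the gamma distribution with integer shape. -/
lemma gammaMeasure_Ioi_le {N : ℕ} (hN : 0 < N) {a : ℝ} (ha : 0 < a)
    (haN : a ^ N * N.factorial = 1) {x : ℝ} (hx : 0 ≤ x) :
    gammaMeasure (N : ℝ) 1 (Ioi x) ≤ ENNReal.ofReal (1 - (1 - Real.exp (-(a * x))) ^ N) := by
  obtain ⟨n, rfl⟩ := Nat.exists_eq_add_one.mpr hN
  have hN' : (0 : ℝ) < ((n + 1 : ℕ) : ℝ) := Nat.cast_pos.mpr hN
  have := isProbabilityMeasure_gammaMeasure hN' one_pos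
  set μ := gammaMeasure ((n + 1 : ℕ) : ℝ) 1
  have hcont : Continuous fun t : ℝ => t ^ n * Real.exp (-t) / n.factorial := by fun_prop
  have hcdf : ∀ x, 0 ≤ x → cdf μ x = ∫ t in (0 : ℝ)..x, t ^ n * Real.exp (-t) / n.factorial := by
    intro x hx
    rw [cdf_gammaMeasure_eq_integral hN' one_pos, intervalIntegral.integral_of_le hx,
      ← integral_Icc_eq_integral_Ioc, setIntegral_eq_of_subset_of_forall_sdiff_eq_zero (s := Icc 0 x)
        measurableSet_Iic Icc_subset_Iic_self]
    · exact setIntegral_congr_fun measurableSet_Icc fun t ht => gammaPDFReal_natCast_add_one n ht.1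
    · intro t ht
      rw [gammaPDFReal, if_neg]
      exact fun h => ht.2 ⟨h, ht.1⟩
  have h := alzer_inequality n ha haN (F := cdf μ) ?_ ?_ ?_ (tendsto_cdf_atTop μ) hx
  · rw [← compl_Iic, prob_compl_eq_one_sub measurableSet_Iic, ← ofReal_cdf, ← ENNReal.ofReal_one,
      ← ENNReal.ofReal_sub _ (cdf_nonneg μ x)]
    exact ENNReal.ofReal_le_ofReal (by linarith)
  · refine ContinuousOn.congr (f := fun x => ∫ t in (0 : ℝ)..x, t ^ n * Real.exp (-t) / n.factorial)
      ?_ fun x hx => hcdf x hx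
    exact (intervalIntegral.continuous_primitive (fun _ _ => hcont.intervalIntegrable _ _) 0).continuousOn
  · rw [hcdf 0 le_rfl, intervalIntegral.integral_same]
  · intro x hx
    refine (hcont.integral_hasStrictDerivAt 0 x).hasDerivAt.congr_of_eventuallyEq ?_
    filter_upwards [Ioi_mem_nhds hx] with y hy
    exact hcdf y (le_of_lt hy)

/-! ### The hypergeometric function as a primitive -/

/-- The `n`-th coefficient of the power series of `₂F₁(1, m + 1; b + 1; ·)`. -/
noncomputable def hypergeometricCoeff (m : ℕ) (b : ℝ) (n : ℕ) : ℝ :=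
  (ascPochhammer ℝ n).eval ((m : ℝ) + 1) / (ascPochhammer ℝ n).eval (b + 1)

lemma ordinaryHypergeometric_eq_tsum_coeff (m : ℕ) (b y : ℝ) :
    ordinaryHypergeometric (1 : ℝ) ((m : ℝ) + 1) (b + 1) y =
      ∑' n, hypergeometricCoeff m b n * y ^ n := by
  rw [ordinaryHypergeometric_eq_tsum]
  refine tsum_congr fun n => ?_
  have h : (n.factorial : ℝ) ≠ 0 := by positivity
  rw [ascPochhammer_eval_one, inv_mul_cancel₀ h, one_mul, smul_eq_mul, hypergeometricCoeff,
    div_eq_mul_inv]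

lemma hypergeometricCoeff_zero (m : ℕ) (b : ℝ) : hypergeometricCoeff m b 0 = 1 := by
  simp [hypergeometricCoeff]

lemma hypergeometricCoeff_succ (m : ℕ) {b : ℝ} (hb : 0 < b) (n : ℕ) :
    (n + 1 + b) * hypergeometricCoeff m b (n + 1) = (m + 1 + n) * hypergeometricCoeff m b n := by
  have h1 : 0 < (ascPochhammer ℝ n).eval (b + 1) := ascPochhammer_pos n _ (by positivity)
  rw [hypergeometricCoeff, hypergeometricCoeff, ascPochhammer_succ_eval, ascPochhammer_succ_eval]
  field_simp
  ring

lemma hypergeometricCoeff_nonneg (m : ℕ) {b : ℝ} (hb : 0 < b) (n : ℕ) : 0 ≤ hypergeometricCoeff m b n :=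
  div_nonneg (ascPochhammer_pos n _ (by positivity)).le (ascPochhammer_pos n _ (by positivity)).le

/-- For `b = 0` the coefficients are these binomials, those of `(1 - y)^(-(m+1))`. A positive `b`
only enlarges the denominators. -/
lemma hypergeometricCoeff_le_choose (m : ℕ) {b : ℝ} (hb : 0 < b) (n : ℕ) :
    hypergeometricCoeff m b n ≤ ((n + m).choose m : ℝ) := by
  induction n with
  | zero => simp [hypergeometricCoeff_zero]
  | succ n ih =>
    have h1 := hypergeometricCoeff_succ m hb n
    have h2 : ((n : ℝ) + 1) * ((n + 1 + m).choose m : ℝ) = (m + 1 + n) * ((n + m).choose m : ℝ) := by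
      have h := Nat.add_one_mul_choose_eq (n + m) n
      rw [← Nat.choose_symm_add, add_right_comm, ← Nat.choose_symm_add]
      have e : n + m + 1 = (n + 1) + m := by ring
      have := congrArg (Nat.cast : ℕ → ℝ) h
      push_cast at this
      rw [e] at this ⊢
      linarith
    have h3 : ((n : ℝ) + 1) * hypergeometricCoeff m b (n + 1) ≤
        (n + 1) * ((n + 1 + m).choose m : ℝ) := by
      rw [h2]
      calc ((n : ℝ) + 1) * hypergeometricCoeff m b (n + 1)
          ≤ (n + 1 + b) * hypergeometricCoeff m b (n + 1) := by
            have := hypergeometricCoeff_nonneg m hb (n + 1)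
            exact mul_le_mul_of_nonneg_right (by linarith) this
        _ ≤ _ := by rw [h1]; gcongr
    exact le_of_mul_le_mul_left h3 (by positivity)

/-- Majorant for the differentiated series: `n` is enlarged to `n + m + 1`, which the binomial
absorbs. -/
lemma hypergeometricCoeff_mul_le (m : ℕ) {b : ℝ} (hb : 0 < b) (n : ℕ) : n * hypergeometricCoeff m b n ≤
    (m + 1) * ((n + (m + 1)).choose (m + 1) : ℝ) := by
  have h := congrArg (Nat.cast : ℕ → ℝ) (Nat.add_one_mul_choose_eq (n + m) m)
  push_cast at h
  calc n * hypergeometricCoeff m b n ≤ (n + m + 1) * ((n + m).choose m : ℝ) := by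
        have h0 := hypergeometricCoeff_nonneg m hb n
        have hm : (0 : ℝ) ≤ m := Nat.cast_nonneg m
        exact mul_le_mul (by linarith) (hypergeometricCoeff_le_choose m hb n) h0 (by positivity)
    _ = _ := by rw [h]; ring_nf

lemma summable_hypergeometricCoeff (m : ℕ) {b : ℝ} (hb : 0 < b)
    {y : ℝ} (hy : |y| < 1) :
    Summable fun n => hypergeometricCoeff m b n * y ^ n := by
  have h := summable_choose_mul_geometric_of_norm_lt_one (R := ℝ) m (r := |y|) (by simpa using hy)
  refine Summable.of_norm_bounded h fun n => ?_
  rw [norm_mul, Real.norm_of_nonneg (hypergeometricCoeff_nonneg m hb n), norm_pow,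
    Real.norm_eq_abs]
  exact mul_le_mul_of_nonneg_right (hypergeometricCoeff_le_choose m hb n) (by positivity)

lemma summable_mul_hypergeometricCoeff (m : ℕ) {b : ℝ} (hb : 0 < b)
    {y : ℝ} (hy : |y| < 1) :
    Summable fun n : ℕ => n * hypergeometricCoeff m b n * y ^ n := by
  have h := (summable_choose_mul_geometric_of_norm_lt_one (R := ℝ) (m + 1) (r := |y|)
    (by simpa using hy)).mul_left ((m : ℝ) + 1)
  refine Summable.of_norm_bounded h fun n => ?_
  have h0 := hypergeometricCoeff_nonneg m hb n
  rw [norm_mul, Real.norm_of_nonneg (by positivity), norm_pow, Real.norm_eq_abs, ← mul_assoc]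
  exact mul_le_mul_of_nonneg_right (hypergeometricCoeff_mul_le m hb n) (by positivity)

lemma hasDerivAt_ordinaryHypergeometric (m : ℕ) {b : ℝ} (hb : 0 < b)
    {y : ℝ} (hy : |y| < 1) :
    HasDerivAt (ordinaryHypergeometric (1 : ℝ) ((m : ℝ) + 1) (b + 1))
      (∑' n : ℕ, hypergeometricCoeff m b n * (n * y ^ (n - 1))) y := by
  -- Termwise differentiation needs a summable bound uniform near `y`; the ball of radius `r < 1`
  -- provides it.
  obtain ⟨r, hyr, hr⟩ := exists_between hy
  have hr0 : 0 < r := (abs_nonneg y).trans_lt hyr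
  have hmem : y ∈ Metric.ball (0 : ℝ) r := by
    rw [mem_ball_zero_iff, Real.norm_eq_abs]; exact hyr
  have hfun : ordinaryHypergeometric (1 : ℝ) ((m : ℝ) + 1) (b + 1) =
      fun y => ∑' n, hypergeometricCoeff m b n * y ^ n :=
    funext fun y => ordinaryHypergeometric_eq_tsum_coeff m b y
  rw [hfun]
  refine hasDerivAt_tsum_of_isPreconnected
    (g := fun n y => hypergeometricCoeff m b n * y ^ n)
    (g' := fun n y => hypergeometricCoeff m b n * (n * y ^ (n - 1)))
    (u := fun n => ((m : ℝ) + 1) * (((n + (m + 1)).choose (m + 1) : ℝ) * r ^ n) / r)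
    (t := Metric.ball (0 : ℝ) r) (y₀ := y) ?_ Metric.isOpen_ball
    (convex_ball (0 : ℝ) r).isPreconnected ?_ ?_ hmem ?_ hmem
  · exact ((summable_choose_mul_geometric_of_norm_lt_one (R := ℝ) (m + 1) (r := r)
      (by rwa [Real.norm_of_nonneg hr0.le])).mul_left _).div_const r
  · intro n z _
    exact (hasDerivAt_pow n z).const_mul _
  · intro n z hz
    rw [mem_ball_zero_iff] at hz
    have h0 := hypergeometricCoeff_nonneg m hb n
    have h1 := hypergeometricCoeff_mul_le m hb n
    have h2 : (n : ℝ) * ‖z‖ ^ (n - 1) ≤ n * (r ^ n / r) := by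
      rcases n with _ | n
      · simp
      · rw [pow_succ r, mul_div_assoc, div_self hr0.ne', mul_one, Nat.add_sub_cancel]
        gcongr
    calc ‖hypergeometricCoeff m b n * (n * z ^ (n - 1))‖
        = hypergeometricCoeff m b n * (n * ‖z‖ ^ (n - 1)) := by
          rw [norm_mul, norm_mul, norm_pow, Real.norm_of_nonneg h0, Real.norm_natCast]
      _ ≤ hypergeometricCoeff m b n * (n * (r ^ n / r)) := by gcongr
      _ = n * hypergeometricCoeff m b n * (r ^ n / r) := by ring
      _ ≤ (m + 1) * ((n + (m + 1)).choose (m + 1) : ℝ) * (r ^ n / r) := by gcongr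
      _ = _ := by ring
  · exact summable_hypergeometricCoeff m hb hy

/-- The first order differential equation of `₂F₁(1, m + 1; b + 1; ·)`. -/
lemma exists_hasDerivAt_ordinaryHypergeometric (m : ℕ) {b : ℝ} (hb : 0 < b)
    {y : ℝ} (hy : |y| < 1) :
    ∃ f', HasDerivAt (ordinaryHypergeometric (1 : ℝ) ((m : ℝ) + 1) (b + 1)) f' y ∧
      y * (1 - y) * f' + (b - (m + 1) * y) *
        ordinaryHypergeometric (1 : ℝ) ((m : ℝ) + 1) (b + 1) y = b := by
  refine ⟨_, hasDerivAt_ordinaryHypergeometric m hb hy, ?_⟩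
  rw [ordinaryHypergeometric_eq_tsum_coeff]
  set c := hypergeometricCoeff m b with hc
  have hS := summable_hypergeometricCoeff m hb hy
  have hS' := summable_mul_hypergeometricCoeff m hb hy
  rw [← hc] at hS hS'
  have hyf : y * ∑' n : ℕ, c n * (n * y ^ (n - 1)) = ∑' n : ℕ, n * c n * y ^ n := by
    rw [← tsum_mul_left]
    refine tsum_congr fun n => ?_
    rcases n with _ | n
    · simp
    · rw [Nat.add_sub_cancel, pow_succ]; ring
  -- The coefficient recurrence summed up: with `θ = y d/dy` it reads `(θ + b) F = b + y (θ + m + 1)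
  -- F`, the lone `b` being the term `n = 0`.
  have h1 : ∑' n : ℕ, n * c n * y ^ n + b * ∑' n, c n * y ^ n =
      b + y * (∑' n : ℕ, n * c n * y ^ n + (m + 1) * ∑' n, c n * y ^ n) := by
    rw [← tsum_mul_left, ← tsum_mul_left, ← hS'.tsum_add (hS.mul_left b),
      ← hS'.tsum_add (hS.mul_left _), (hS'.add (hS.mul_left b)).tsum_eq_zero_add, ← tsum_mul_left]
    congr 1
    · simp [hc, hypergeometricCoeff_zero]
    · refine tsum_congr fun n => ?_
      have := hypergeometricCoeff_succ m hb n
      rw [← hc] at this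
      push_cast
      rw [pow_succ]
      linear_combination (y ^ n * y) * this
  linear_combination h1 + (1 - y) * hyf

/-- `v ^ b / (b (σ + v) ^ (m + 1)) ₂F₁(1, m + 1; b + 1; v / (v + σ))` is a primitive of
`v ^ (b - 1) / (v + σ) ^ (m + 1)`. -/
lemma hasDerivAt_hypergeometric_primitive (m : ℕ) {b : ℝ} (hb : 0 < b)
    {σ v : ℝ} (hσ : 0 < σ) (hv : 0 < v) :
    HasDerivAt (fun v : ℝ => v ^ b / (b * (σ + v) ^ (m + 1)) *
      ordinaryHypergeometric (1 : ℝ) ((m : ℝ) + 1) (b + 1) (v / (v + σ)))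
      (v ^ (b - 1) / (σ + v) ^ (m + 1)) v := by
  have hs : 0 < v + σ := by positivity
  obtain ⟨f', hf', hode⟩ := exists_hasDerivAt_ordinaryHypergeometric m hb
    (y := v / (v + σ)) (by
      rw [abs_of_nonneg (by positivity)]
      exact (div_lt_one hs).mpr (by linarith))
  have h1 : HasDerivAt (fun v : ℝ => v / (v + σ)) (σ / (v + σ) ^ 2) v := by
    refine ((hasDerivAt_id v).div ((hasDerivAt_id v).add_const σ) hs.ne').congr_deriv ?_
    simp
  have h2 := hf'.comp v h1
  have h3 : HasDerivAt (fun v : ℝ => v ^ b) (b * v ^ (b - 1)) v :=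
    Real.hasDerivAt_rpow_const (Or.inl hv.ne')
  have h4 : HasDerivAt (fun v : ℝ => b * (σ + v) ^ (m + 1)) (b * ((m + 1) * (σ + v) ^ m)) v := by
    refine ((((hasDerivAt_id v).const_add σ).pow (m + 1)).const_mul b).congr_deriv ?_
    simp
  have hs' : σ + v ≠ 0 := by rw [add_comm]; exact hs.ne'
  refine ((h3.div h4 (mul_ne_zero hb.ne' (pow_ne_zero _ hs'))).mul h2).congr_deriv ?_
  have h5 : v ^ b = v ^ (b - 1) * v := by rw [Real.rpow_sub_one hv.ne']; field_simp
  simp only [Function.comp, Pi.div_apply, h5]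
  rw [add_comm v σ] at hode ⊢
  generalize ordinaryHypergeometric (1 : ℝ) ((m : ℝ) + 1) (b + 1) (v / (σ + v)) = f at hode ⊢
  generalize v ^ (b - 1) = w
  field_simp at hode ⊢
  -- With `y = v / (σ + v)` and `1 - y = σ / (σ + v)`, what remains is a multiple of the
  -- differential equation.
  linear_combination w * (σ + v) ^ (m + 1) * hode

/-- The value `v = 0` is the point of this: it corresponds to the centre of the disc in the inner
integral and to infinity in the outer one. -/
lemma continuousAt_hypergeometric_primitive (m : ℕ) {b : ℝ} (hb : 0 < b)
    {σ v : ℝ} (hσ : 0 < σ) (hv : 0 ≤ v) :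
    ContinuousAt (fun v : ℝ => v ^ b / (b * (σ + v) ^ (m + 1)) *
      ordinaryHypergeometric (1 : ℝ) ((m : ℝ) + 1) (b + 1) (v / (v + σ))) v := by
  have hs : 0 < v + σ := by positivity
  have hs' : σ + v ≠ 0 := by rw [add_comm]; exact hs.ne'
  have h1 : ContinuousAt (fun v : ℝ => v / (v + σ)) v :=
    continuousAt_id.div (by fun_prop) hs.ne'
  have h2 : |v / (v + σ)| < 1 := by
    rw [abs_of_nonneg (by positivity)]
    exact (div_lt_one hs).mpr (by linarith)
  refine ContinuousAt.mul (ContinuousAt.div (Real.continuous_rpow_const hb.le).continuousAt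
    (by fun_prop) (mul_ne_zero hb.ne' (pow_ne_zero _ hs'))) ?_
  exact ContinuousAt.comp (f := fun v : ℝ => v / (v + σ))
    (hasDerivAt_ordinaryHypergeometric m hb h2).continuousAt h1

/-! ### Laplace functionals of Poisson processes and of independent marks -/

lemma ProbabilityTheory.iIndepFun.lintegral_finsetProd {Ω ι : Type*} [MeasurableSpace Ω]
    {P : Measure Ω} {X : ι → Ω → ℝ≥0∞} (h : iIndepFun X P) (hX : ∀ i, Measurable (X i))
    (s : Finset ι) : ∫⁻ ω, ∏ i ∈ s, X i ω ∂P = ∏ i ∈ s, ∫⁻ ω, X i ω ∂P := by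
  classical
  have : IsProbabilityMeasure P := h.isProbabilityMeasure
  induction s using Finset.induction_on with
  | empty => simp
  | insert i s hi ih =>
    have h1 := lintegral_mul_eq_lintegral_mul_lintegral_of_indepFun
      (f := ∏ i ∈ s, X i)
      (by simpa only [Finset.prod_fn] using Finset.measurable_prod s fun i _ => hX i) (hX i)
      (h.indepFun_finsetProd_of_notMem hX hi)
    simp only [Pi.mul_apply, Finset.prod_apply] at h1
    rw [Finset.prod_insert hi, ← ih, mul_comm, ← h1]
    exact lintegral_congr fun ω => by rw [Finset.prod_insert hi, mul_comm]

/-- The sum of `h` over the first `n` entries of the sequence `y`. -/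
noncomputable def listSum {E : Type*} (h : E → ℝ≥0∞) (n : ℕ∞) (y : ℕ → E) : ℝ≥0∞ :=
  ∑' i : ℕ, if (i : ℕ∞) < n then h (y i) else 0

lemma measurable_listSum {α E : Type*} [MeasurableSpace α] [MeasurableSpace E]
    {h : α → E → ℝ≥0∞} (hh : Measurable (Function.uncurry h)) {n : α → ℕ∞} (hn : Measurable n)
    {y : ℕ → α → E} (hy : ∀ i, Measurable (y i)) :
    Measurable fun a => listSum (h a) (n a) fun i => y i a := by
  refine Measurable.tsum fun i => Measurable.ite ?_ ?_ measurable_const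
  · exact hn (MeasurableSet.of_discrete (s := {k : ℕ∞ | (i : ℕ∞) < k}))
  · exact hh.comp (measurable_id.prodMk (hy i))

lemma tendsto_listSum {E : Type*} {g : ℕ → E → ℝ≥0∞} {h : E → ℝ≥0∞} (hg : Monotone g)
    (hlim : ∀ x, Filter.Tendsto (fun k => g k x) Filter.atTop (nhds (h x))) (n : ℕ∞) (y : ℕ → E) :
    Filter.Tendsto (fun k => listSum (g k) n y) Filter.atTop (nhds (listSum h n y)) := by
  simp only [listSum, ← lintegral_count]
  refine lintegral_tendsto_of_tendsto_of_monotone (fun k => (measurable_of_countable _).aemeasurable)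
    (ae_of_all _ fun i k l hkl => ?_) (ae_of_all _ fun i => ?_)
  · split_ifs
    · exact hg hkl _
    · exact le_rfl
  · split_ifs
    · exact hlim _
    · exact tendsto_const_nhds

namespace MmWave.PointProcess

variable {Ω E : Type*} [MeasurableSpace Ω] [MeasurableSpace E]

lemma coe_numberIn (Φ : PointProcess Ω E) (B : Set E) (ω : Ω) :
    (Φ.numberIn B ω : ℝ≥0∞) = listSum (B.indicator 1) (Φ.count ω) fun i => Φ.point i ω := by
  classical
  rw [numberIn, ← ENNReal.tsum_set_one, tsum_subtype _ (fun _ => (1 : ℝ≥0∞)), listSum]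
  refine tsum_congr fun i => ?_
  by_cases h1 : (i : ℕ∞) < Φ.count ω <;> by_cases h2 : Φ.point i ω ∈ B <;> simp [h1, h2]

lemma measurable_numberIn (Φ : PointProcess Ω E) {B : Set E} (hB : MeasurableSet B) :
    Measurable (Φ.numberIn B) := by
  have h : Measurable fun ω => (Φ.numberIn B ω : ℝ≥0∞) := by
    simp only [coe_numberIn]
    exact measurable_listSum (h := fun _ => B.indicator 1)
      ((measurable_one.indicator hB).comp measurable_snd) Φ.measurable_count Φ.measurable_point
  refine measurable_to_countable' fun k => ?_
  have : Φ.numberIn B ⁻¹' {k} = (fun ω => (Φ.numberIn B ω : ℝ≥0∞)) ⁻¹' {(k : ℝ≥0∞)} := by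
    ext ω; simp
  rw [this]
  exact h (measurableSet_singleton _)

/-- The Laplace transform of a Poisson random variable. -/
lemma lintegral_negExp_of_poisson {P : Measure Ω} [IsProbabilityMeasure P] {N : Ω → ℕ∞}
    (hN : Measurable N) {l : ℝ} (hl : 0 ≤ l)
    (hP : ∀ k : ℕ, P {ω | N ω = k} = ENNReal.ofReal (Real.exp (-l) * l ^ k / (k.factorial : ℝ)))
    (v : ℝ≥0∞) : ∫⁻ ω, negExp (v * N ω) ∂P = negExp ((1 - negExp v) * ENNReal.ofReal l) := by
  have hexp : ∀ p : ℝ, 0 ≤ p → ∑' k : ℕ, ENNReal.ofReal (p ^ k) *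
      ENNReal.ofReal (Real.exp (-l) * l ^ k / (k.factorial : ℝ)) =
      ENNReal.ofReal (Real.exp (-((1 - p) * l))) := by
    intro p hp
    have hs : HasSum (fun k : ℕ => p ^ k * (Real.exp (-l) * l ^ k / (k.factorial : ℝ)))
        (Real.exp (-((1 - p) * l))) := by
      have := (NormedSpace.expSeries_div_hasSum_exp (p * l)).mul_left (Real.exp (-l))
      rw [← Real.exp_eq_exp_ℝ, ← Real.exp_add] at this
      rw [show -((1 - p) * l) = -l + p * l by ring]
      refine this.congr_fun fun k => ?_
      rw [mul_pow]
      ring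
    rw [← hs.tsum_eq, ENNReal.ofReal_tsum_of_nonneg (fun k => by positivity) hs.summable]
    exact tsum_congr fun k => (ENNReal.ofReal_mul (by positivity)).symm
  have hms : ∀ k : ℕ, MeasurableSet {ω | N ω = k} := fun k => hN (measurableSet_singleton (k : ℕ∞))
  have hdisj : Pairwise (Function.onFun Disjoint fun k : ℕ => {ω | N ω = k}) := by
    intro j k hjk
    refine Set.disjoint_left.mpr fun ω h1 h2 => hjk ?_
    have : ((j : ℕ) : ℕ∞) = k := h1.symm.trans h2
    exact_mod_cast this
  -- The Poisson weights sum to one, so the value `∞` of `N` has probability zero.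
  have hfull : P (⋃ k : ℕ, {ω | N ω = k}) = 1 := by
    rw [measure_iUnion hdisj hms]
    have := hexp 1 zero_le_one
    simpa [hP] using this
  have hae : ∀ᵐ ω ∂P, ω ∈ ⋃ k : ℕ, {ω | N ω = k} :=
    (prob_compl_eq_zero_iff (MeasurableSet.iUnion hms)).mpr hfull
  rw [← Measure.restrict_eq_self_of_ae_mem hae, lintegral_iUnion hms hdisj]
  have hp := hexp (negExp v).toReal ENNReal.toReal_nonneg
  have h1 : (1 - negExp v) * ENNReal.ofReal l =
      ENNReal.ofReal ((1 - (negExp v).toReal) * l) := by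
    rw [ENNReal.ofReal_mul' hl, ENNReal.ofReal_sub _ ENNReal.toReal_nonneg, ENNReal.ofReal_one,
      ENNReal.ofReal_toReal (negExp_ne_top v)]
  have h2 : 0 ≤ 1 - (negExp v).toReal := by
    have := ENNReal.toReal_mono ENNReal.one_ne_top (negExp_le_one v)
    simpa using this
  rw [h1, negExp_ofReal (mul_nonneg h2 hl), ← hp]
  refine tsum_congr fun k => ?_
  rw [setLIntegral_congr_fun (g := fun _ => negExp v ^ k) (hms k) fun ω hω => ?_,
    setLIntegral_const, hP, ENNReal.ofReal_pow ENNReal.toReal_nonneg,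
    ENNReal.ofReal_toReal (negExp_ne_top v)]
  have hω' : N ω = k := hω
  dsimp only
  rw [hω', mul_comm, ENat.toENNReal_coe, negExp_nat_mul]

/-- The sum of `g` over the points is `∑ v * (number of points in the fibre over v)`. Fibres over
distinct values are disjoint, so the expectation factors into Poisson Laplace transforms. The fibre
over `0` may have infinite measure, but contributes nothing. -/
lemma IsPoisson.lintegral_negExp_simpleFunc {Φ : PointProcess Ω E} {Λ : Measure E} {P : Measure Ω}
    [IsProbabilityMeasure P] (hΦ : Φ.IsPoisson Λ P) (g : SimpleFunc E ℝ≥0∞)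
    (hg : ∀ v, v ≠ 0 → Λ (g ⁻¹' {v}) < ∞) :
    ∫⁻ ω, negExp (listSum g (Φ.count ω) fun i => Φ.point i ω) ∂P =
      negExp (∫⁻ x, (1 - negExp (g x)) ∂Λ) := by
  classical
  set s := g.range.filter (· ≠ 0) with hs
  have e := s.equivFin.symm
  set B : Fin s.card → Set E := fun i => g ⁻¹' {(e i : ℝ≥0∞)} with hB
  have he : ∀ i, (e i : ℝ≥0∞) ≠ 0 := fun i => (Finset.mem_filter.mp (e i).2).2
  have hBm : ∀ i, MeasurableSet (B i) := fun i => g.measurableSet_fiber _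
  have hdisj : Pairwise fun i j => Disjoint (B i) (B j) := by
    intro i j hij
    refine Set.disjoint_left.mpr fun x h1 h2 => hij ?_
    exact e.injective (Subtype.ext ((show g x = e i from h1).symm.trans h2))
  have hval : ∀ x, g x = ∑ i, (e i : ℝ≥0∞) * (B i).indicator 1 x := by
    intro x
    by_cases hx : g x = 0
    · rw [hx]
      symm
      refine Finset.sum_eq_zero fun i _ => ?_
      have : x ∉ B i := fun h => he i ((show g x = e i from h).symm.trans hx)
      simp [this]
    · have hxs : g x ∈ s := Finset.mem_filter.mpr ⟨SimpleFunc.mem_range_self g x, hx⟩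
      obtain ⟨i, hi⟩ := e.surjective ⟨g x, hxs⟩
      have hi' : (e i : ℝ≥0∞) = g x := by rw [hi]
      rw [Finset.sum_eq_single i]
      · have : x ∈ B i := hi'.symm
        simp [this, hi']
      · intro j _ hj
        have : x ∉ B j := fun h => hj (e.injective (Subtype.ext
          ((show g x = e j from h).symm.trans hi'.symm)))
        simp [this]
      · simp
  have hsum : ∀ ω, listSum g (Φ.count ω) (fun i => Φ.point i ω) =
      ∑ i, (e i : ℝ≥0∞) * Φ.numberIn (B i) ω := by
    intro ω
    simp only [coe_numberIn, listSum, ← ENNReal.tsum_mul_left]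
    rw [← Summable.tsum_finsetSum fun _ _ => ENNReal.summable]
    refine tsum_congr fun k => ?_
    split_ifs
    · exact hval _
    · simp
  have hind := (hΦ.indep s.card B hBm hdisj).comp (fun i k => negExp ((e i : ℝ≥0∞) * k))
    fun i => measurable_of_countable _
  have hmeas : ∀ i, Measurable fun ω => negExp ((e i : ℝ≥0∞) * Φ.numberIn (B i) ω) := fun i =>
    (measurable_of_countable fun k : ℕ∞ => negExp ((e i : ℝ≥0∞) * k)).comp
      (Φ.measurable_numberIn (hBm i))
  calc ∫⁻ ω, negExp (listSum g (Φ.count ω) fun i => Φ.point i ω) ∂P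
      = ∫⁻ ω, ∏ i, negExp ((e i : ℝ≥0∞) * Φ.numberIn (B i) ω) ∂P := by
        simp only [hsum, negExp_sum]
    _ = ∏ i, ∫⁻ ω, negExp ((e i : ℝ≥0∞) * Φ.numberIn (B i) ω) ∂P :=
        hind.lintegral_finsetProd hmeas _
    _ = ∏ i, negExp ((1 - negExp (e i)) * Λ (B i)) := by
        refine Finset.prod_congr rfl fun i _ => ?_
        have hfin := hg (e i) (he i)
        rw [lintegral_negExp_of_poisson (Φ.measurable_numberIn (hBm i)) ENNReal.toReal_nonneg
          (hΦ.poisson (B i) (hBm i) hfin), ENNReal.ofReal_toReal hfin.ne]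
    _ = negExp (∫⁻ x, (1 - negExp (g x)) ∂Λ) := by
        rw [← negExp_sum]
        congr 1
        have h1 : ∫⁻ x, (1 - negExp (g x)) ∂Λ = (g.map fun v => 1 - negExp v).lintegral Λ := by
          rw [← SimpleFunc.lintegral_eq_lintegral]; rfl
        rw [h1, SimpleFunc.map_lintegral, ← Finset.sum_filter_of_ne (s := g.range)
          (p := (· ≠ (0 : ℝ≥0∞))), ← hs, ← Finset.sum_coe_sort s (fun v => (1 - negExp v) * Λ (g ⁻¹' {v})),
          ← Equiv.sum_comp e]
        intro v _ hv h0
        simp [h0] at hv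

/-- The Laplace functional of a Poisson point process. -/
lemma IsPoisson.lintegral_negExp {Φ : PointProcess Ω E} {Λ : Measure E} [SigmaFinite Λ]
    {P : Measure Ω} [IsProbabilityMeasure P] (hΦ : Φ.IsPoisson Λ P) {h : E → ℝ≥0∞}
    (hh : Measurable h) :
    ∫⁻ ω, negExp (listSum h (Φ.count ω) fun i => Φ.point i ω) ∂P =
      negExp (∫⁻ x, (1 - negExp (h x)) ∂Λ) := by
  -- Restricting to spanning sets gives the fibres over nonzero values finite measure, and the
  -- approximation stays monotone.
  set g : ℕ → SimpleFunc E ℝ≥0∞ := fun n =>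
    (SimpleFunc.eapprox h n).restrict (spanningSets Λ n) with hg
  have hgx : ∀ n x, g n x = (spanningSets Λ n).indicator (SimpleFunc.eapprox h n) x := fun n x =>
    SimpleFunc.restrict_apply _ (measurableSet_spanningSets Λ n) x
  have hmono : Monotone fun n x => g n x := by
    intro m n hmn x
    simp only [hgx]
    exact (indicator_le_indicator_of_subset (monotone_spanningSets Λ hmn) (fun _ => zero_le) x).trans
      (indicator_le_indicator (SimpleFunc.monotone_eapprox h hmn x))
  have hlim : ∀ x, Filter.Tendsto (fun n => g n x) Filter.atTop (nhds (h x)) := by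
    intro x
    have h1 : Filter.Tendsto (fun n => SimpleFunc.eapprox h n x) Filter.atTop (nhds (h x)) := by
      rw [← SimpleFunc.iSup_eapprox_apply hh x]
      exact tendsto_atTop_iSup fun m n hmn => SimpleFunc.monotone_eapprox h hmn x
    refine h1.congr' ?_
    filter_upwards [Filter.eventually_ge_atTop (spanningSetsIndex Λ x)] with n hn
    rw [hgx, indicator_of_mem]
    exact mem_spanningSets_of_index_le Λ x hn
  have hfin : ∀ n v, v ≠ 0 → Λ (g n ⁻¹' {v}) < ∞ := by
    intro n v hv
    rw [hg, SimpleFunc.restrict_preimage_singleton _ (measurableSet_spanningSets Λ n) hv]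
    exact (measure_mono inter_subset_left).trans_lt (measure_spanningSets_lt_top Λ n)
  have hL : Filter.Tendsto (fun n => ∫⁻ ω, negExp (listSum (g n) (Φ.count ω) fun i => Φ.point i ω) ∂P)
      Filter.atTop (nhds (∫⁻ ω, negExp (listSum h (Φ.count ω) fun i => Φ.point i ω) ∂P)) := by
    refine tendsto_lintegral_of_dominated_convergence (fun _ => 1) ?_ ?_ (by simp) ?_
    · intro n
      exact measurable_negExp.comp (measurable_listSum (h := fun _ => g n)
        ((g n).measurable.comp measurable_snd) Φ.measurable_count Φ.measurable_point)
    · exact fun n => ae_of_all _ fun ω => negExp_le_one _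
    · exact ae_of_all _ fun ω => (continuous_negExp.tendsto _).comp (tendsto_listSum hmono hlim _ _)
  have hR : Filter.Tendsto (fun n => negExp (∫⁻ x, (1 - negExp (g n x)) ∂Λ))
      Filter.atTop (nhds (negExp (∫⁻ x, (1 - negExp (h x)) ∂Λ))) := by
    refine (continuous_negExp.tendsto _).comp ?_
    refine lintegral_tendsto_of_tendsto_of_monotone ?_ ?_ ?_
    · exact fun n => (measurable_const.sub (measurable_negExp.comp (g n).measurable)).aemeasurable
    · exact ae_of_all _ fun x m n hmn => tsub_le_tsub_left (antitone_negExp (hmono hmn x)) 1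
    · refine ae_of_all _ fun x => ENNReal.Tendsto.sub tendsto_const_nhds
        ((continuous_negExp.tendsto _).comp (hlim x)) (Or.inl ENNReal.one_ne_top)
  refine tendsto_nhds_unique hL ?_
  simp only [hΦ.lintegral_negExp_simpleFunc (g _) (hfin _)]
  exact hR

end MmWave.PointProcess

/-- The Laplace transform of a sum over independent marks attached to the entries of a list. -/
lemma lintegral_infinitePi_negExp_tsum {M : Type*} [MeasurableSpace M] (μ : Measure M)
    [IsProbabilityMeasure μ] {g : ℕ → M → ℝ≥0∞} (hg : ∀ i, Measurable (g i)) :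
    ∫⁻ w, negExp (∑' i, g i (w i)) ∂(Measure.infinitePi fun _ : ℕ => μ) =
      negExp (∑' i, negLog (∫⁻ m, negExp (g i m) ∂μ)) := by
  have hle : ∀ i, ∫⁻ m, negExp (g i m) ∂μ ≤ 1 := fun i =>
    (lintegral_mono fun m => negExp_le_one _).trans (by simp)
  have hind : iIndepFun (fun i (w : ℕ → M) => negExp (g i (w i)))
      (Measure.infinitePi fun _ : ℕ => μ) :=
    iIndepFun_infinitePi (X := fun i m => negExp (g i m)) fun i => measurable_negExp.comp (hg i)
  have hmeas : ∀ i, Measurable fun w : ℕ → M => negExp (g i (w i)) := fun i =>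
    measurable_negExp.comp ((hg i).comp (measurable_pi_apply i))
  have hfin : ∀ n, ∫⁻ w, negExp (∑ i ∈ Finset.range n, g i (w i))
      ∂(Measure.infinitePi fun _ : ℕ => μ) =
      negExp (∑ i ∈ Finset.range n, negLog (∫⁻ m, negExp (g i m) ∂μ)) := by
    intro n
    simp only [negExp_sum]
    rw [hind.lintegral_finsetProd hmeas]
    refine Finset.prod_congr rfl fun i _ => ?_
    rw [negExp_negLog (hle i)]
    exact (measurePreserving_eval_infinitePi (fun _ : ℕ => μ) i).lintegral_comp
      (measurable_negExp.comp (hg i))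
  -- Both sides are limits of the partial sums: the left by dominated convergence with bound `1`,
  -- the right by continuity of `negExp`.
  refine tendsto_nhds_unique (f := fun n => ∫⁻ w, negExp (∑ i ∈ Finset.range n, g i (w i))
      ∂(Measure.infinitePi fun _ : ℕ => μ)) (l := Filter.atTop) ?_ ?_
  · refine tendsto_lintegral_of_dominated_convergence (fun _ => 1) ?_ ?_ (by simp) ?_
    · exact fun n => measurable_negExp.comp (Finset.measurable_sum _ fun i _ =>
        (hg i).comp (measurable_pi_apply i))
    · exact fun n => ae_of_all _ fun w => negExp_le_one _
    · exact ae_of_all _ fun w => (continuous_negExp.tendsto _).comp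
        (ENNReal.tendsto_nat_tsum fun i => g i (w i))
  · simp only [hfin]
    exact (continuous_negExp.tendsto _).comp (ENNReal.tendsto_nat_tsum _)

/-! ### Radial integrals of the fading loss -/

/-- A telescoping sum of differences of consecutive powers of `1 / (1 + w)`. It is the origin of the
sum over `m` in `Psi`. -/
lemma one_sub_inv_one_add_pow (N : ℕ) {w : ℝ} (hw : 0 ≤ w) :
    1 - ((1 + w) ^ N)⁻¹ = ∑ m ∈ Finset.range N, w / (1 + w) ^ (m + 1) := by
  induction N with
  | zero => simp
  | succ N ih =>
    rw [Finset.sum_range_succ, ← ih]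
    have : (1 + w) ≠ 0 := by positivity
    field_simp
    ring

/-- One minus the Laplace transform at `s` of the received power `K r ^ (-α) g`, where `g` has
the law `gamma(N, 1)`. -/
noncomputable def fadingLoss (K α : ℝ) (N : ℕ) (s r : ℝ) : ℝ :=
  1 - ((1 + s * (K * r ^ (-α))) ^ N)⁻¹

lemma fadingLoss_nonneg {K α s r : ℝ} (N : ℕ) (hK : 0 ≤ K) (hs : 0 ≤ s) (hr : 0 ≤ r) :
    0 ≤ fadingLoss K α N s r := by
  have h : 0 ≤ s * (K * r ^ (-α)) := by positivity
  have := inv_le_one_of_one_le₀ (one_le_pow₀ (n := N) (by linarith : 1 ≤ 1 + s * (K * r ^ (-α))))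
  rw [fadingLoss]
  linarith

lemma fadingLoss_le_one {K α s r : ℝ} (N : ℕ) (hK : 0 ≤ K) (hs : 0 ≤ s) (hr : 0 ≤ r) :
    fadingLoss K α N s r ≤ 1 := by
  have h : 0 ≤ s * (K * r ^ (-α)) := by positivity
  have : 0 ≤ ((1 + s * (K * r ^ (-α))) ^ N)⁻¹ := by positivity
  rw [fadingLoss]
  linarith

lemma fadingLoss_eq_sum {K α s r : ℝ} (N : ℕ) (hK : 0 < K) (hs : 0 < s) (hr : 0 < r) :
    fadingLoss K α N s r =
      ∑ m ∈ Finset.range N, s * (r ^ α / K) ^ m / (s + r ^ α / K) ^ (m + 1) := by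
  rw [fadingLoss, one_sub_inv_one_add_pow N (by positivity)]
  refine Finset.sum_congr rfl fun m _ => ?_
  have hra : 0 < r ^ α := Real.rpow_pos_of_pos hr α
  have h1 : s * (K * r ^ (-α)) = s / (r ^ α / K) := by
    rw [Real.rpow_neg hr.le]; field_simp
  have hu : 0 < r ^ α / K := by positivity
  rw [h1]
  generalize r ^ α / K = u at hu
  have h2 : 1 + s / u = (s + u) / u := by field_simp; ring
  rw [h2, div_pow, pow_succ u]
  field_simp

/-- The substitution `v = r^α / K` in `hasDerivAt_hypergeometric_primitive`, with `σ = s` and `b = m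
+ 2/α`. This primitive vanishes at `r = 0`. -/
lemma hasDerivAt_fadingLoss_inner {K α s : ℝ} (hK : 0 < K) (hα : 0 < α) (hs : 0 < s) (m : ℕ) {r : ℝ}
    (hr : 0 < r) :
    HasDerivAt (fun r : ℝ => s * (K ^ (2 / α) / α) * ((r ^ α / K) ^ ((m : ℝ) + 2 / α) /
      (((m : ℝ) + 2 / α) * (s + r ^ α / K) ^ (m + 1)) *
      ordinaryHypergeometric (1 : ℝ) ((m : ℝ) + 1) ((m : ℝ) + 2 / α + 1)
        ((r ^ α / K) / (r ^ α / K + s))))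
      (s * (r ^ α / K) ^ m / (s + r ^ α / K) ^ (m + 1) * r) r := by
  have hra : 0 < r ^ α := Real.rpow_pos_of_pos hr α
  have hu : 0 < r ^ α / K := by positivity
  have hb : 0 < (m : ℝ) + 2 / α := by positivity
  have h1 : HasDerivAt (fun r : ℝ => r ^ α / K) (α * r ^ (α - 1) / K) r :=
    (Real.hasDerivAt_rpow_const (Or.inl hr.ne')).div_const K
  have h2 := ((hasDerivAt_hypergeometric_primitive m hb hs hu).comp r h1).const_mul
    (s * (K ^ (2 / α) / α))
  refine h2.congr_deriv ?_
  have h3 : (r ^ α / K) ^ ((m : ℝ) + 2 / α - 1) =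
      (r ^ α / K) ^ m * (r ^ 2 / K ^ (2 / α)) / (r ^ α / K) := by
    rw [Real.rpow_sub_one hu.ne', Real.rpow_add hu, Real.rpow_natCast,
      Real.div_rpow hra.le hK.le (2 / α), ← Real.rpow_mul hr.le]
    congr 3
    rw [show α * (2 / α) = (2 : ℕ) by field_simp; norm_num, Real.rpow_natCast]
  rw [h3, Real.rpow_sub_one hr.ne']
  have : 0 < K ^ (2 / α) := Real.rpow_pos_of_pos hK _
  generalize K ^ (2 / α) = k at *
  generalize (r ^ α / K) ^ m = p
  have hS : 0 < s + r ^ α / K := by positivity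
  generalize (s + r ^ α / K) ^ (m + 1) = S
  field_simp

/-- The same integrand after the inverse substitution `v = K r^(-α)`, with `σ = 1/s` and `b = 1 -
2/α`, which is positive because `α > 2`. This primitive vanishes at infinity. -/
lemma hasDerivAt_fadingLoss_outer {K α s : ℝ} (hK : 0 < K) (hα : 2 < α) (hs : 0 < s) (m : ℕ) {r : ℝ}
    (hr : 0 < r) :
    HasDerivAt (fun r : ℝ => -(s * (K ^ (2 / α) / α) / s ^ (m + 1)) *
      ((K * r ^ (-α)) ^ (1 - 2 / α) / ((1 - 2 / α) * (s⁻¹ + K * r ^ (-α)) ^ (m + 1)) *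
      ordinaryHypergeometric (1 : ℝ) ((m : ℝ) + 1) (1 - 2 / α + 1)
        ((K * r ^ (-α)) / (K * r ^ (-α) + s⁻¹))))
      (s * (r ^ α / K) ^ m / (s + r ^ α / K) ^ (m + 1) * r) r := by
  have hα0 : 0 < α := by linarith
  have hra : 0 < r ^ α := Real.rpow_pos_of_pos hr α
  have hra' : 0 < r ^ (-α) := Real.rpow_pos_of_pos hr _
  have hu : 0 < K * r ^ (-α) := by positivity
  have hb : 0 < 1 - 2 / α := by rw [sub_pos, div_lt_one hα0]; exact hα
  have h1 : HasDerivAt (fun r : ℝ => K * r ^ (-α)) (K * (-α * r ^ (-α - 1))) r :=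
    (Real.hasDerivAt_rpow_const (Or.inl hr.ne')).const_mul K
  have h2 := ((hasDerivAt_hypergeometric_primitive m hb (inv_pos.mpr hs) hu).comp r h1).const_mul
    (-(s * (K ^ (2 / α) / α) / s ^ (m + 1)))
  refine h2.congr_deriv ?_
  have h3 : (K * r ^ (-α)) ^ (1 - 2 / α - 1) = r ^ 2 / K ^ (2 / α) := by
    rw [show 1 - 2 / α - 1 = -(2 / α) by ring, Real.rpow_neg hu.le,
      Real.mul_rpow hK.le hra'.le, ← Real.rpow_mul hr.le,
      show -α * (2 / α) = -(2 : ℕ) by field_simp; norm_num, Real.rpow_neg hr.le, Real.rpow_natCast,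
      mul_inv, inv_inv]
    ring
  rw [h3, Real.rpow_sub_one hr.ne', Real.rpow_neg hr.le]
  have : 0 < K ^ (2 / α) := Real.rpow_pos_of_pos hK _
  generalize K ^ (2 / α) = k at *
  generalize r ^ α = x at *
  have h4 : s⁻¹ + K * x⁻¹ = (s + x / K) * K / (s * x) := by field_simp; ring
  have hS : 0 < s + x / K := by positivity
  rw [h4, div_pow, div_pow, mul_pow, mul_pow]
  generalize s + x / K = S at *
  field_simp
  ring

/-- The integral of the fading loss over a disc, in polar coordinates. -/
lemma integral_fadingLoss_inner {K α s D : ℝ} (hK : 0 < K) (hα : 0 < α) (hs : 0 < s) (hD : 0 < D)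
    (N : ℕ) :
    IntervalIntegrable (fun r => fadingLoss K α N s r * r) volume 0 D ∧
    ∫ r in (0 : ℝ)..D, fadingLoss K α N s r * r =
      s * (K ^ (2 / α) / α) * ∑ m ∈ Finset.range N,
        ((D ^ α / K) ^ ((m : ℝ) + 2 / α) / (((m : ℝ) + 2 / α) * (s + D ^ α / K) ^ (m + 1)) *
        ordinaryHypergeometric (1 : ℝ) ((m : ℝ) + 1) ((m : ℝ) + 2 / α + 1)
          ((D ^ α / K) / (D ^ α / K + s))) := by
  set G : ℕ → ℝ → ℝ := fun m r => s * (K ^ (2 / α) / α) * ((r ^ α / K) ^ ((m : ℝ) + 2 / α) /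
    (((m : ℝ) + 2 / α) * (s + r ^ α / K) ^ (m + 1)) *
    ordinaryHypergeometric (1 : ℝ) ((m : ℝ) + 1) ((m : ℝ) + 2 / α + 1)
      ((r ^ α / K) / (r ^ α / K + s))) with hG
  set g : ℕ → ℝ → ℝ := fun m r => s * (r ^ α / K) ^ m / (s + r ^ α / K) ^ (m + 1) * r with hg
  have hb : ∀ m : ℕ, 0 < (m : ℝ) + 2 / α := fun m => by positivity
  have hd : ∀ m, ∀ r ∈ Ioo 0 D, HasDerivAt (G m) (g m r) r := fun m r hr =>
    hasDerivAt_fadingLoss_inner hK hα hs m hr.1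
  have hc : ∀ m, ContinuousOn (G m) (Icc 0 D) := by
    intro m r hr
    have h1 : ContinuousAt (fun r : ℝ => r ^ α / K) r :=
      ((Real.continuous_rpow_const hα.le).div_const K).continuousAt
    have hu : 0 ≤ r ^ α / K := div_nonneg (Real.rpow_nonneg hr.1 α) hK.le
    exact ((ContinuousAt.comp (f := fun r : ℝ => r ^ α / K)
      (continuousAt_hypergeometric_primitive m (hb m) hs hu) h1).const_mul _).continuousWithinAt
  have hnn : ∀ m, ∀ r ∈ Ioo 0 D, 0 ≤ g m r := by
    intro m r hr
    have := hr.1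
    have : 0 < r ^ α := Real.rpow_pos_of_pos hr.1 α
    positivity
  -- Integrability needs no estimate: a nonnegative derivative of a continuous function is
  -- integrable.
  have hint : ∀ m, IntervalIntegrable (g m) volume 0 D := fun m =>
    (intervalIntegrable_iff_integrableOn_Ioc_of_le hD.le).mpr
      (intervalIntegral.integrableOn_deriv_of_nonneg (hc m) (hd m) (hnn m))
  have hval : ∀ m, ∫ r in (0 : ℝ)..D, g m r = G m D := by
    intro m
    rw [intervalIntegral.integral_eq_sub_of_hasDerivAt_of_le hD.le (hc m) (hd m) (hint m)]
    have : G m 0 = 0 := by simp [hG, Real.zero_rpow hα.ne', Real.zero_rpow (hb m).ne']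
    rw [this, sub_zero]
  have hEq : EqOn (fun r => ∑ m ∈ Finset.range N, g m r) (fun r => fadingLoss K α N s r * r)
      (uIoc 0 D) := by
    intro r hr
    rw [uIoc_of_le hD.le] at hr
    simp only [hg]
    rw [fadingLoss_eq_sum N hK hs hr.1, Finset.sum_mul]
  have hI : IntervalIntegrable (fun r => ∑ m ∈ Finset.range N, g m r) volume 0 D := by
    simpa only [Finset.sum_fn] using IntervalIntegrable.sum (Finset.range N) fun m _ => hint m
  refine ⟨hI.congr hEq, ?_⟩
  rw [← intervalIntegral.integral_congr_ae (ae_of_all _ fun r hr => hEq hr),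
    intervalIntegral.integral_finsetSum fun m _ => hint m, Finset.mul_sum]
  exact Finset.sum_congr rfl fun m _ => hval m

/-- The integral of the fading loss over the complement of a disc, in polar coordinates. -/
lemma integral_fadingLoss_outer {K α s D : ℝ} (hK : 0 < K) (hα : 2 < α) (hs : 0 < s) (hD : 0 < D)
    (N : ℕ) :
    IntegrableOn (fun r => fadingLoss K α N s r * r) (Ioi D) ∧
    ∫ r in Ioi D, fadingLoss K α N s r * r =
      s * (K ^ (2 / α) / α) * ∑ m ∈ Finset.range N,
        ((D ^ α / K) ^ ((m : ℝ) + 2 / α) / ((1 - 2 / α) * (s + D ^ α / K) ^ (m + 1)) *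
        ordinaryHypergeometric (1 : ℝ) ((m : ℝ) + 1) (2 - 2 / α)
          (s / (s + D ^ α / K))) := by
  have hα0 : 0 < α := by linarith
  have hb : 0 < 1 - 2 / α := by rw [sub_pos, div_lt_one hα0]; exact hα
  set G : ℕ → ℝ → ℝ := fun m r => -(s * (K ^ (2 / α) / α) / s ^ (m + 1)) *
    ((K * r ^ (-α)) ^ (1 - 2 / α) / ((1 - 2 / α) * (s⁻¹ + K * r ^ (-α)) ^ (m + 1)) *
    ordinaryHypergeometric (1 : ℝ) ((m : ℝ) + 1) (1 - 2 / α + 1)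
      ((K * r ^ (-α)) / (K * r ^ (-α) + s⁻¹))) with hG
  set g : ℕ → ℝ → ℝ := fun m r => s * (r ^ α / K) ^ m / (s + r ^ α / K) ^ (m + 1) * r with hg
  have hd : ∀ m, ∀ r, 0 < r → HasDerivAt (G m) (g m r) r := fun m r hr =>
    hasDerivAt_fadingLoss_outer hK hα hs m hr
  have hc : ∀ m, ContinuousWithinAt (G m) (Ici D) D := fun m =>
    (hd m D hD).continuousAt.continuousWithinAt
  have hnn : ∀ m, ∀ r ∈ Ioi D, 0 ≤ g m r := by
    intro m r hr
    have h0 : 0 < r := hD.trans hr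
    have : 0 < r ^ α := Real.rpow_pos_of_pos h0 α
    positivity
  have hlim : ∀ m, Filter.Tendsto (G m) Filter.atTop (nhds 0) := by
    intro m
    have h1 : Filter.Tendsto (fun r : ℝ => K * r ^ (-α)) Filter.atTop (nhds 0) := by
      simpa using (tendsto_rpow_neg_atTop hα0).const_mul K
    have h2 := (((continuousAt_hypergeometric_primitive m hb (inv_pos.mpr hs) le_rfl).tendsto).comp
      h1).const_mul (-(s * (K ^ (2 / α) / α) / s ^ (m + 1)))
    simpa [hG, Real.zero_rpow hb.ne', Function.comp_def] using h2
  have hd' : ∀ m, ∀ r ∈ Ioi D, HasDerivAt (G m) (g m r) r := fun m r hr => hd m r (hD.trans hr)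
  have hint : ∀ m, IntegrableOn (g m) (Ioi D) := fun m =>
    integrableOn_Ioi_deriv_of_nonneg (hc m) (hd' m) (hnn m) (hlim m)
  have hval : ∀ m, ∫ r in Ioi D, g m r = s * (K ^ (2 / α) / α) *
      ((D ^ α / K) ^ ((m : ℝ) + 2 / α) / ((1 - 2 / α) * (s + D ^ α / K) ^ (m + 1)) *
        ordinaryHypergeometric (1 : ℝ) ((m : ℝ) + 1) (2 - 2 / α) (s / (s + D ^ α / K))) := by
    intro m
    rw [integral_Ioi_of_hasDerivAt_of_nonneg (hc m) (hd' m) (hnn m) (hlim m), zero_sub, hG]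
    have hDa : 0 < D ^ α := Real.rpow_pos_of_pos hD α
    have hk : 0 < D ^ α / K := by positivity
    have e1 : K * D ^ (-α) = (D ^ α / K)⁻¹ := by rw [Real.rpow_neg hD.le]; field_simp
    have e3 : ((D ^ α / K)⁻¹) ^ (1 - 2 / α) * (D ^ α / K) ^ (m + 1) =
        (D ^ α / K) ^ ((m : ℝ) + 2 / α) := by
      rw [Real.inv_rpow hk.le, ← Real.rpow_neg hk.le, ← Real.rpow_natCast, ← Real.rpow_add hk]
      congr 1
      push_cast
      ring
    have e4 : 1 - 2 / α + 1 = 2 - 2 / α := by ring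
    dsimp only
    rw [e1, e4, ← e3]
    generalize D ^ α / K = k at hk
    have e2 : k⁻¹ / (k⁻¹ + s⁻¹) = s / (s + k) := by field_simp
    have e5 : s⁻¹ + k⁻¹ = (s + k) / (s * k) := by field_simp; ring
    rw [e2, e5, div_pow, mul_pow]
    have : 0 < s + k := by positivity
    field_simp
  have hEq : EqOn (fun r => ∑ m ∈ Finset.range N, g m r) (fun r => fadingLoss K α N s r * r)
      (Ioi D) := by
    intro r hr
    simp only [hg]
    rw [fadingLoss_eq_sum N hK hs (hD.trans hr), Finset.sum_mul]
  have hI : IntegrableOn (fun r => ∑ m ∈ Finset.range N, g m r) (Ioi D) :=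
    integrable_finsetSum _ fun m _ => hint m
  refine ⟨hI.congr_fun hEq measurableSet_Ioi, ?_⟩
  rw [← setIntegral_congr_fun measurableSet_Ioi hEq, integral_finsetSum _ fun m _ => hint m,
    Finset.mul_sum]
  exact Finset.sum_congr rfl fun m _ => hval m

/-! ### Gamma transform and polar coordinates -/

/-- The Laplace transform of the gamma distribution. -/
lemma lintegral_negExp_gammaMeasure {N : ℕ} (hN : 0 < N) {c : ℝ} (hc : 0 ≤ c) :
    ∫⁻ g, negExp (ENNReal.ofReal (c * g)) ∂(gammaMeasure (N : ℝ) 1) =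
      ENNReal.ofReal ((1 + c) ^ N)⁻¹ := by
  have hN' : (0 : ℝ) < N := Nat.cast_pos.mpr hN
  have hc' : 0 < 1 + c := by positivity
  have hm : Measurable fun g : ℝ => negExp (ENNReal.ofReal (c * g)) :=
    measurable_negExp.comp (by fun_prop)
  have hpdf : Measurable (gammaPDF (N : ℝ) 1) := (measurable_gammaPDFReal _ _).ennreal_ofReal
  have hpdf' : Measurable (gammaPDF (N : ℝ) (1 + c)) :=
    (measurable_gammaPDFReal _ _).ennreal_ofReal
  -- Exponential tilting: `e^{-cg}` times the density of rate `1` is `(1 + c)^(-N)` times the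
  -- density of rate `1 + c`, which has mass one.
  rw [gammaMeasure, lintegral_withDensity_eq_lintegral_mul _ hpdf hm, ← mul_one (ENNReal.ofReal _),
    ← lintegral_gammaPDF_eq_one hN' hc',
    ← lintegral_const_mul _ hpdf']
  refine lintegral_congr fun g => ?_
  rcases lt_or_ge g 0 with hg | hg
  · simp [gammaPDF_of_neg hg]
  · rw [Pi.mul_apply, negExp_ofReal (mul_nonneg hc hg), gammaPDF_of_nonneg hg,
      gammaPDF_of_nonneg hg, ← ENNReal.ofReal_mul (by positivity),
      ← ENNReal.ofReal_mul (by positivity)]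
    congr 1
    have h1 : Real.exp (-((1 + c) * g)) = Real.exp (-(1 * g)) * Real.exp (-(c * g)) := by
      rw [← Real.exp_add]; congr 1; ring
    rw [h1, Real.one_rpow, Real.rpow_natCast]
    field_simp

lemma sigmaFinite_ofReal_smul {E : Type*} [MeasurableSpace E] (c : ℝ) (μ : Measure E)
    [SigmaFinite μ] : SigmaFinite (ENNReal.ofReal c • μ) :=
  inferInstanceAs (SigmaFinite (c.toNNReal • μ))

/-- Integration of a radial function on the plane in polar coordinates. -/
lemma lintegral_plane_dist {f : ℝ → ℝ} (hf : IntegrableOn (fun r => f r * r) (Ioi 0))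
    (hf0 : ∀ r, 0 < r → 0 ≤ f r) (z : MmWave.Plane) :
    ∫⁻ y, ENNReal.ofReal (f (dist y z)) =
      ENNReal.ofReal (2 * Real.pi * ∫ r in Ioi (0 : ℝ), f r * r) := by
  have hdim : Module.finrank ℝ MmWave.Plane = 2 := by simp
  have h1 : ∫⁻ y, ENNReal.ofReal (f (dist y z)) = ∫⁻ y : MmWave.Plane, ENNReal.ofReal (f ‖y‖) := by
    simp only [dist_eq_norm]
    exact lintegral_sub_right_eq_self (fun y : MmWave.Plane => ENNReal.ofReal (f ‖y‖)) z
  have hfun : (fun y : ℝ => y ^ (Module.finrank ℝ MmWave.Plane - 1) • f y) = fun r => f r * r := by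
    ext r; rw [hdim]; simp [mul_comm]
  have hint : Integrable (fun y : MmWave.Plane => f ‖y‖) := by
    rw [integrable_fun_norm_addHaar, hfun]
    exact hf
  have hnn : 0 ≤ᵐ[volume] fun y : MmWave.Plane => f ‖y‖ := by
    filter_upwards [Measure.ae_ne volume (0 : MmWave.Plane)] with y hy
    exact hf0 _ (norm_pos_iff.mpr hy)
  rw [h1, ← ofReal_integral_eq_lintegral_ofReal hint hnn, integral_fun_norm_addHaar, hfun, hdim,
    Measure.real, EuclideanSpace.volume_ball_fin_two]
  congr 1
  simp [mul_assoc, Real.pi_pos.le]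

/-! ### The Laplace transform of the artificial noise -/

namespace MmWave.Network

variable (net : Network)

lemma alpha_pos (j : LinkState) : 0 < net.alpha j := by
  cases j
  · exact net.alpha_LOS_pos
  · exact two_pos.trans net.two_lt_alpha_NLOS

lemma qL_nonneg (r : ℝ) : 0 ≤ net.qL r := by
  unfold qL; split_ifs
  · exact net.C_nonneg
  · exact le_rfl

lemma qL_le_one (r : ℝ) : net.qL r ≤ 1 := by
  unfold qL; split_ifs
  · exact net.C_le_one
  · exact zero_le_one

lemma probMa_nonneg : 0 ≤ net.probMa := by
  have := net.thetaB_le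
  unfold probMa; apply div_nonneg <;> linarith

lemma probMs_nonneg : 0 ≤ net.probMs := by
  have := net.thetaB_nonneg
  unfold probMs; positivity

lemma measurable_qL : Measurable net.qL :=
  Measurable.ite measurableSet_Iic measurable_const measurable_const

lemma measurable_pathGain (j : LinkState) : Measurable (net.pathGain j) := by
  unfold pathGain; fun_prop

lemma measurable_linkGain : Measurable fun p : ℝ × LinkMark => net.linkGain p.1 p.2 := by
  have h1 := net.measurable_qL
  have h2 := net.measurable_pathGain
  unfold linkGain
  refine Measurable.ite (measurableSet_le (by fun_prop) (by fun_prop)) ?_ ?_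
  · exact ((h2 _).comp measurable_fst).mul (by fun_prop)
  · exact ((h2 _).comp measurable_fst).mul (by fun_prop)

/-- Averaging over the state of a link. -/
lemma lintegral_linkLaw_ite {q : ℝ} (hq0 : 0 ≤ q) (hq1 : q ≤ 1) {F G : ℝ → ℝ≥0∞}
    (hF : Measurable F) (hG : Measurable G) :
    ∫⁻ m, (if m.1 ≤ q then F m.2.1 else G m.2.2) ∂net.linkLaw =
      ENNReal.ofReal q * ∫⁻ g, F g ∂net.fadingLaw .LOS +
        ENNReal.ofReal (1 - q) * ∫⁻ g, G g ∂net.fadingLaw .NLOS := by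
  have hm : Measurable fun m : LinkMark => if m.1 ≤ q then F m.2.1 else G m.2.2 :=
    Measurable.ite (measurableSet_le measurable_fst measurable_const) (by fun_prop) (by fun_prop)
  have hinner : ∀ u : ℝ, ∫⁻ p : ℝ × ℝ, (if u ≤ q then F p.1 else G p.2)
      ∂((net.fadingLaw .LOS).prod (net.fadingLaw .NLOS)) =
      (Iic q).indicator (fun _ => ∫⁻ g, F g ∂net.fadingLaw .LOS) u +
      (Ioi q).indicator (fun _ => ∫⁻ g, G g ∂net.fadingLaw .NLOS) u := by
    intro u
    by_cases hu : u ≤ q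
    · have := measurePreserving_fst (μ := net.fadingLaw .LOS) (ν := net.fadingLaw .NLOS)
        |>.lintegral_comp hF
      simpa [hu, not_lt.mpr hu] using this
    · have := measurePreserving_snd (μ := net.fadingLaw .LOS) (ν := net.fadingLaw .NLOS)
        |>.lintegral_comp hG
      simpa [hu, not_le.mp hu] using this
  have e1 : (volume.restrict (Icc (0 : ℝ) 1)) (Iic q) = ENNReal.ofReal q := by
    rw [Measure.restrict_apply measurableSet_Iic, show Iic q ∩ Icc 0 1 = Icc 0 q by
      ext u; simp only [mem_inter_iff, mem_Iic, mem_Icc]; constructor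
      · exact fun h => ⟨h.2.1, h.1⟩
      · exact fun h => ⟨h.2, h.1, h.2.trans hq1⟩]
    simp
  have e2 : (volume.restrict (Icc (0 : ℝ) 1)) (Ioi q) = ENNReal.ofReal (1 - q) := by
    rw [Measure.restrict_apply measurableSet_Ioi, show Ioi q ∩ Icc 0 1 = Ioc q 1 by
      ext u; simp only [mem_inter_iff, mem_Ioi, mem_Icc, mem_Ioc]; constructor
      · exact fun h => ⟨h.1, h.2.2⟩
      · exact fun h => ⟨h.1, hq0.trans h.1.le, h.2⟩]
    simp
  rw [linkLaw, lintegral_prod _ hm.aemeasurable]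
  simp only [hinner]
  rw [lintegral_add_left (measurable_const.indicator measurableSet_Iic),
    lintegral_indicator_const measurableSet_Iic, lintegral_indicator_const measurableSet_Ioi, e1, e2,
    mul_comm, mul_comm (lintegral _ _)]

/-- The fading loss of an artificial noise link of state `j`. -/
noncomputable def linkLoss (j : LinkState) (s r : ℝ) : ℝ :=
  fadingLoss (net.Ma * net.intercept j) (net.alpha j) (net.shape j) s r

/-- One minus the Laplace transform of the normalized noise power over a link of length `r`. -/
noncomputable def meanLoss (s r : ℝ) : ℝ :=
  net.qL r * net.linkLoss .LOS s r + (1 - net.qL r) * net.linkLoss .NLOS s r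

lemma Ma_mul_intercept_pos (j : LinkState) : 0 < net.Ma * net.intercept j :=
  mul_pos net.Ma_pos (net.intercept_pos j)

lemma linkLoss_nonneg (j : LinkState) {s r : ℝ} (hs : 0 ≤ s) (hr : 0 ≤ r) :
    0 ≤ net.linkLoss j s r := fadingLoss_nonneg _ (net.Ma_mul_intercept_pos j).le hs hr

lemma linkLoss_le_one (j : LinkState) {s r : ℝ} (hs : 0 ≤ s) (hr : 0 ≤ r) :
    net.linkLoss j s r ≤ 1 := fadingLoss_le_one _ (net.Ma_mul_intercept_pos j).le hs hr

lemma meanLoss_nonneg {s r : ℝ} (hs : 0 ≤ s) (hr : 0 ≤ r) : 0 ≤ net.meanLoss s r :=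
  add_nonneg (mul_nonneg (net.qL_nonneg r) (net.linkLoss_nonneg _ hs hr))
    (mul_nonneg (sub_nonneg.mpr (net.qL_le_one r)) (net.linkLoss_nonneg _ hs hr))

lemma meanLoss_le_one {s r : ℝ} (hs : 0 ≤ s) (hr : 0 ≤ r) : net.meanLoss s r ≤ 1 := by
  have h1 := mul_le_mul_of_nonneg_left (net.linkLoss_le_one .LOS hs hr) (net.qL_nonneg r)
  have h2 := mul_le_mul_of_nonneg_left (net.linkLoss_le_one .NLOS hs hr)
    (sub_nonneg.mpr (net.qL_le_one r))
  rw [meanLoss]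
  linarith

lemma lintegral_negExp_fadingLaw (j : LinkState) {s r : ℝ} (hs : 0 ≤ s) (hr : 0 ≤ r) :
    ∫⁻ g, negExp (ENNReal.ofReal (s * (net.Ma * (net.pathGain j r * g)))) ∂net.fadingLaw j =
      ENNReal.ofReal (1 - net.linkLoss j s r) := by
  have hM := net.Ma_pos
  have hC := net.intercept_pos j
  have h : ∀ g : ℝ, s * (net.Ma * (net.pathGain j r * g)) =
      s * (net.Ma * net.intercept j * r ^ (-net.alpha j)) * g := fun g => by
    rw [pathGain]; ring
  simp only [h]
  rw [fadingLaw, lintegral_negExp_gammaMeasure (net.shape j).pos (by positivity), linkLoss,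
    fadingLoss, sub_sub_cancel]

lemma lintegral_negExp_linkGain {s r : ℝ} (hs : 0 ≤ s) (hr : 0 ≤ r) :
    ∫⁻ m, negExp (ENNReal.ofReal (s * (net.Ma * net.linkGain r m))) ∂net.linkLaw =
      ENNReal.ofReal (1 - net.meanLoss s r) := by
  have h : ∀ m : LinkMark, negExp (ENNReal.ofReal (s * (net.Ma * net.linkGain r m))) =
      if m.1 ≤ net.qL r then
        negExp (ENNReal.ofReal (s * (net.Ma * (net.pathGain .LOS r * m.2.1))))
      else negExp (ENNReal.ofReal (s * (net.Ma * (net.pathGain .NLOS r * m.2.2)))) := by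
    intro m; unfold linkGain; split_ifs <;> rfl
  have hm : ∀ j, Measurable fun g : ℝ =>
      negExp (ENNReal.ofReal (s * (net.Ma * (net.pathGain j r * g)))) := fun j =>
    measurable_negExp.comp (by fun_prop)
  simp only [h]
  rw [net.lintegral_linkLaw_ite (net.qL_nonneg r) (net.qL_le_one r) (hm .LOS) (hm .NLOS),
    net.lintegral_negExp_fadingLaw _ hs hr, net.lintegral_negExp_fadingLaw _ hs hr,
    ← ENNReal.ofReal_mul (net.qL_nonneg r),
    ← ENNReal.ofReal_mul (sub_nonneg.mpr (net.qL_le_one r)), ← ENNReal.ofReal_add]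
  · congr 1; rw [meanLoss]; ring
  · exact mul_nonneg (net.qL_nonneg r) (sub_nonneg.mpr (net.linkLoss_le_one _ hs hr))
  · exact mul_nonneg (sub_nonneg.mpr (net.qL_le_one r))
      (sub_nonneg.mpr (net.linkLoss_le_one _ hs hr))

/-- Splitting a radial integral at the line-of-sight radius. -/
lemma integral_mixture {f g : ℝ → ℝ}
    (hf : IntervalIntegrable (fun r => f r * r) volume 0 net.D)
    (hg : IntervalIntegrable (fun r => g r * r) volume 0 net.D)
    (hg' : IntegrableOn (fun r => g r * r) (Ioi net.D)) :
    IntegrableOn (fun r => (net.qL r * f r + (1 - net.qL r) * g r) * r) (Ioi 0) ∧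
    ∫ r in Ioi (0 : ℝ), (net.qL r * f r + (1 - net.qL r) * g r) * r =
      net.C * (∫ r in (0 : ℝ)..net.D, f r * r) + (1 - net.C) * (∫ r in (0 : ℝ)..net.D, g r * r) +
        ∫ r in Ioi net.D, g r * r := by
  have hD := net.D_pos.le
  rw [intervalIntegrable_iff_integrableOn_Ioc_of_le hD] at hf hg
  have e1 : EqOn (fun r => (net.qL r * f r + (1 - net.qL r) * g r) * r)
      (fun r => net.C * (f r * r) + (1 - net.C) * (g r * r)) (Ioc 0 net.D) := by
    intro r hr
    simp only [qL, if_pos hr.2]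
    ring
  -- Beyond `D` the weight of the line-of-sight term is zero, which is why its path loss exponent
  -- need only be positive.
  have e2 : EqOn (fun r => (net.qL r * f r + (1 - net.qL r) * g r) * r)
      (fun r => g r * r) (Ioi net.D) := by
    intro r hr
    simp only [qL, if_neg (not_le.mpr (mem_Ioi.mp hr))]
    ring
  have i1 : IntegrableOn (fun r => (net.qL r * f r + (1 - net.qL r) * g r) * r) (Ioc 0 net.D) :=
    IntegrableOn.congr_fun ((hf.const_mul _).add (hg.const_mul _)) e1.symm measurableSet_Ioc
  have i2 : IntegrableOn (fun r => (net.qL r * f r + (1 - net.qL r) * g r) * r) (Ioi net.D) :=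
    IntegrableOn.congr_fun hg' e2.symm measurableSet_Ioi
  rw [← Ioc_union_Ioi_eq_Ioi hD]
  refine ⟨i1.union i2, ?_⟩
  rw [setIntegral_union (Ioc_disjoint_Ioi le_rfl) measurableSet_Ioi i1 i2,
    setIntegral_congr_fun measurableSet_Ioc e1, setIntegral_congr_fun measurableSet_Ioi e2,
    integral_add (hf.const_mul _) (hg.const_mul _), integral_const_mul, integral_const_mul,
    intervalIntegral.integral_of_le hD, intervalIntegral.integral_of_le hD]

lemma integral_linkLoss_inner (j : LinkState) {s : ℝ} (hs : 0 ≤ s) :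
    IntervalIntegrable (fun r => net.linkLoss j s r * r) volume 0 net.D ∧
    net.probMa * ∫ r in (0 : ℝ)..net.D, net.linkLoss j s r * r = s * net.psiIn j s := by
  rcases hs.eq_or_lt with rfl | hs
  · simp [linkLoss, fadingLoss]
  · obtain ⟨h1, h2⟩ := integral_fadingLoss_inner (net.Ma_mul_intercept_pos j) (net.alpha_pos j) hs
      net.D_pos (net.shape j)
    refine ⟨h1, ?_⟩
    simp only [linkLoss]
    rw [h2, psiIn]
    simp only [prefactor, ratio]
    ring

lemma integral_linkLoss_outer {s : ℝ} (hs : 0 ≤ s) :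
    IntegrableOn (fun r => net.linkLoss .NLOS s r * r) (Ioi net.D) ∧
    net.probMa * ∫ r in Ioi net.D, net.linkLoss .NLOS s r * r = s * net.psiOut s := by
  rcases hs.eq_or_lt with rfl | hs
  · simp [linkLoss, fadingLoss]
  · obtain ⟨h1, h2⟩ := integral_fadingLoss_outer (net.Ma_mul_intercept_pos .NLOS)
      net.two_lt_alpha_NLOS hs net.D_pos (net.shape .NLOS)
    refine ⟨h1, ?_⟩
    simp only [linkLoss]
    rw [h2, psiOut]
    simp only [prefactor, ratio]
    ring

lemma integrableOn_meanLoss {s : ℝ} (hs : 0 ≤ s) :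
    IntegrableOn (fun r => net.meanLoss s r * r) (Ioi 0) :=
  (net.integral_mixture (net.integral_linkLoss_inner .LOS hs).1
    (net.integral_linkLoss_inner .NLOS hs).1 (net.integral_linkLoss_outer hs).1).1

/-- The link between closed form and probability. Sign, measurability and the Laplace transform of
the noise are all read off from this integral, not from the hypergeometric series. -/
lemma Psi_eq_integral {s : ℝ} (hs : 0 ≤ s) :
    net.Psi s = -(net.lamB * net.probMa *
      (2 * Real.pi * ∫ r in Ioi (0 : ℝ), net.meanLoss s r * r)) := by
  have h := (net.integral_mixture (net.integral_linkLoss_inner .LOS hs).1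
    (net.integral_linkLoss_inner .NLOS hs).1 (net.integral_linkLoss_outer hs).1).2
  have h1 := (net.integral_linkLoss_inner .LOS hs).2
  have h2 := (net.integral_linkLoss_inner .NLOS hs).2
  have h3 := (net.integral_linkLoss_outer hs).2
  simp only [meanLoss]
  rw [h, Psi]
  simp only [q]
  linear_combination (2 * Real.pi * net.lamB) * (net.C * h1 + (1 - net.C) * h2 + h3)

lemma Psi_nonpos {s : ℝ} (hs : 0 ≤ s) : net.Psi s ≤ 0 := by
  rw [net.Psi_eq_integral hs, neg_nonpos]
  have := net.lamB_nonneg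
  have := net.probMa_nonneg
  have : 0 ≤ ∫ r in Ioi (0 : ℝ), net.meanLoss s r * r :=
    setIntegral_nonneg measurableSet_Ioi fun r hr =>
      mul_nonneg (net.meanLoss_nonneg hs (le_of_lt hr)) (le_of_lt hr)
  positivity

lemma measurable_meanLoss : Measurable fun p : ℝ × ℝ => net.meanLoss p.1 p.2 := by
  have := net.measurable_qL
  unfold meanLoss linkLoss fadingLoss
  fun_prop

/-- A measurable function that agrees with `Psi` on `[0, ∞)`. -/
lemma exists_measurable_eq_Psi : ∃ f : ℝ → ℝ, Measurable f ∧ ∀ s, 0 ≤ s → net.Psi s = f s := by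
  refine ⟨_, ?_, fun s hs => net.Psi_eq_integral hs⟩
  have h : Measurable fun p : ℝ × ℝ => net.meanLoss p.1 p.2 * p.2 :=
    net.measurable_meanLoss.mul measurable_snd
  have := h.stronglyMeasurable.integral_prod_right' (ν := volume.restrict (Ioi (0 : ℝ)))
  exact ((this.measurable.const_mul _).const_mul _).neg

/-- The Laplace transform of the artificial noise at a point `z`. -/
lemma lintegral_negExp_noiseInterference {Ω : Type*} [MeasurableSpace Ω] {P : Measure Ω}
    [IsProbabilityMeasure P] {ΦA : PointProcess Ω Plane}
    (hA : ΦA.IsPoisson (ENNReal.ofReal (net.lamB * net.probMa) • volume) P) {t : ℝ} (ht : 0 ≤ t)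
    (z : Plane) :
    ∫⁻ ω, ∫⁻ w, negExp (ENNReal.ofReal t *
        net.noiseInterference (ΦA.count ω) (fun k => ΦA.point k ω) z w)
        ∂(Measure.infinitePi fun _ : ℕ => net.linkLaw) ∂P =
      ENNReal.ofReal (Real.exp (net.Psi ((1 - net.phi) * net.Pt * t))) := by
  set s := (1 - net.phi) * net.Pt * t with hs_def
  have hs : 0 ≤ s := mul_nonneg (mul_nonneg (sub_nonneg.mpr net.phi_le_one) net.Pt_pos.le) ht
  -- Minus the logarithm of the transform of one link. Averaging over the marks leaves `negExp` of a
  -- sum of `h` over the stations, and `1 - negExp h` is `meanLoss`.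
  set h : Plane → ℝ≥0∞ := fun y => negLog (ENNReal.ofReal (1 - net.meanLoss s (dist y z))) with hh
  have hmeas : Measurable h := by
    refine measurable_negLog.comp (ENNReal.measurable_ofReal.comp ?_)
    exact (net.measurable_meanLoss.comp
      (measurable_const.prodMk (measurable_id.dist measurable_const))).const_sub 1
  have hin : ∀ ω, ∫⁻ w, negExp (ENNReal.ofReal t *
        net.noiseInterference (ΦA.count ω) (fun k => ΦA.point k ω) z w)
        ∂(Measure.infinitePi fun _ : ℕ => net.linkLaw) =
      negExp (listSum h (ΦA.count ω) fun k => ΦA.point k ω) := by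
    intro ω
    set g : ℕ → LinkMark → ℝ≥0∞ := fun i m => if (i : ℕ∞) < ΦA.count ω then
      ENNReal.ofReal (s * (net.Ma * net.linkGain (dist (ΦA.point i ω) z) m)) else 0 with hg
    have hgm : ∀ i, Measurable (g i) := by
      intro i
      have := net.measurable_linkGain.comp
        (measurable_prodMk_left (x := dist (ΦA.point i ω) z) (β := LinkMark))
      simp only [hg]
      split_ifs
      · exact ENNReal.measurable_ofReal.comp ((this.const_mul _).const_mul _)
      · exact measurable_const
    have h1 : ∀ w : ℕ → LinkMark, ENNReal.ofReal t *
        net.noiseInterference (ΦA.count ω) (fun k => ΦA.point k ω) z w = ∑' i, g i (w i) := by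
      intro w
      rw [noiseInterference, ← ENNReal.tsum_mul_left]
      refine tsum_congr fun i => ?_
      simp only [hg]
      split_ifs
      · rw [← ENNReal.ofReal_mul ht]
        congr 1
        rw [hs_def]; ring
      · simp
    simp only [h1]
    rw [lintegral_infinitePi_negExp_tsum net.linkLaw hgm, listSum]
    congr 1
    refine tsum_congr fun i => ?_
    simp only [hg]
    split_ifs
    · rw [net.lintegral_negExp_linkGain hs dist_nonneg]
    -- Entries beyond the count do not belong to the process; they contribute `-log 1 = 0`.
    · simp [negLog]
  have := sigmaFinite_ofReal_smul (net.lamB * net.probMa) (volume : Measure Plane)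
  simp only [hin]
  rw [hA.lintegral_negExp hmeas, lintegral_smul_measure]
  have h2 : ∀ y, 1 - negExp (h y) = ENNReal.ofReal (net.meanLoss s (dist y z)) := by
    intro y
    have h0 := net.meanLoss_nonneg hs (dist_nonneg (x := y) (y := z))
    have h1 := net.meanLoss_le_one hs (dist_nonneg (x := y) (y := z))
    rw [hh, negExp_negLog (ENNReal.ofReal_le_one.mpr (by linarith)), ← ENNReal.ofReal_one,
      ← ENNReal.ofReal_sub _ (by linarith), sub_sub_cancel]
  simp only [h2]
  rw [lintegral_plane_dist (net.integrableOn_meanLoss hs)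
    (fun r hr => net.meanLoss_nonneg hs hr.le) z, smul_eq_mul,
    ← ENNReal.ofReal_mul (mul_nonneg net.lamB_nonneg net.probMa_nonneg), negExp_ofReal,
    net.Psi_eq_integral hs]
  have := net.Psi_nonpos hs
  rw [net.Psi_eq_integral hs] at this
  linarith

end MmWave.Network

/-! ### From the gamma tail to `Omega` -/

lemma one_sub_one_sub_pow (N : ℕ) (z : ℝ) : 1 - (1 - z) ^ N =
    ∑ n ∈ Finset.Icc 1 N, (-1 : ℝ) ^ (n + 1) * (N.choose n : ℝ) * z ^ n := by
  have h := add_pow (-z) 1 N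
  rw [Finset.range_eq_Ico, Finset.sum_eq_sum_Ico_succ_bot (by omega)] at h
  have e : Finset.Icc 1 N = Finset.Ico (0 + 1) (N + 1) := by
    ext i; simp only [Finset.mem_Icc, Finset.mem_Ico]; omega
  rw [show 1 - z = -z + 1 by ring, h, e]
  simp only [pow_zero, one_pow, Nat.choose_zero_right, Nat.cast_one, mul_one]
  rw [sub_add_cancel_left, ← Finset.sum_neg_distrib]
  refine Finset.sum_congr rfl fun n _ => ?_
  rw [neg_pow z, pow_succ (-1 : ℝ)]
  ring

/-- Tail bound for the gamma distribution, at a threshold in `[0, ∞]`. -/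
lemma gammaMeasure_lt_ofReal_le {N : ℕ} (hN : 0 < N) {a : ℝ} (ha : 0 < a)
    (haN : a ^ N * N.factorial = 1) (X : ℝ≥0∞) :
    gammaMeasure (N : ℝ) 1 {g | X < ENNReal.ofReal g} ≤
      ENNReal.ofReal (1 - (1 - (negExp (ENNReal.ofReal a * X)).toReal) ^ N) := by
  induction X using ENNReal.recTopCoe with
  | top => simp
  | coe X =>
    rw [← ENNReal.ofReal_coe_nnreal, ← ENNReal.ofReal_mul ha.le,
      negExp_ofReal (mul_nonneg ha.le X.coe_nonneg), ENNReal.toReal_ofReal (Real.exp_nonneg _)]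
    have : {g : ℝ | ENNReal.ofReal X < ENNReal.ofReal g} = Ioi (X : ℝ) := by
      ext g
      exact ENNReal.ofReal_lt_ofReal_iff_of_nonneg X.coe_nonneg
    rw [this]
    exact gammaMeasure_Ioi_le hN ha haN X.coe_nonneg

namespace MmWave.Network

variable (net : Network)

lemma a_pos (j : LinkState) : 0 < net.a j := Real.rpow_pos_of_pos (by positivity) _

lemma a_pow_mul_factorial (j : LinkState) :
    net.a j ^ (net.shape j : ℕ) * ((net.shape j : ℕ).factorial : ℝ) = 1 := by
  have hN : ((net.shape j : ℕ) : ℝ) ≠ 0 := Nat.cast_ne_zero.mpr (net.shape j).ne_zero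
  have hf : (0 : ℝ) < ((net.shape j : ℕ).factorial : ℝ) := by positivity
  rw [a, ← Real.rpow_natCast, ← Real.rpow_mul hf.le, div_mul_cancel₀ _ hN, Real.rpow_neg_one,
    inv_mul_cancel₀ hf.ne']

lemma measurable_noiseInterference {α : Type*} [MeasurableSpace α] {n : α → ℕ∞}
    {y : ℕ → α → Plane} {z : α → Plane} {w : ℕ → α → LinkMark} (hn : Measurable n)
    (hy : ∀ i, Measurable (y i)) (hz : Measurable z) (hw : ∀ i, Measurable (w i)) :
    Measurable fun b => net.noiseInterference (n b) (fun i => y i b) (z b) fun i => w i b := by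
  unfold noiseInterference
  refine Measurable.tsum fun i => Measurable.ite ?_ ?_ measurable_const
  · exact hn (MeasurableSet.of_discrete (s := {k : ℕ∞ | (i : ℕ∞) < k}))
  · exact ENNReal.measurable_ofReal.comp ((net.measurable_linkGain.comp
      (((hy i).dist hz).prodMk (hw i))).const_mul _)

/-- The fading power over a link of state `j` and length `r` that is needed per unit of
interference and noise to exceed the threshold. -/
noncomputable def fadingThreshold (j : LinkState) (r : ℝ) : ℝ :=
  net.Te * r ^ net.alpha j / (net.phi * net.Pt * net.Ms * net.intercept j)

lemma fadingThreshold_nonneg (j : LinkState) {r : ℝ} (hr : 0 ≤ r) :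
    0 ≤ net.fadingThreshold j r := by
  have := net.Te_pos
  have := net.phi_pos
  have := net.Pt_pos
  have := net.Ms_pos
  have := net.intercept_pos j
  unfold fadingThreshold
  positivity

/-- The exponential bound for the probability that the SINR over a link of state `j` and
length `r` exceeds the threshold, when interference and noise have total power `Y`. -/
noncomputable def tailBound (j : LinkState) (r : ℝ) (Y : ℝ≥0∞) : ℝ :=
  1 - (1 - (negExp (ENNReal.ofReal (net.a j * net.fadingThreshold j r) * Y)).toReal) ^
    (net.shape j : ℕ)

lemma measurable_tailBound (j : LinkState) (r : ℝ) : Measurable (net.tailBound j r) := by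
  unfold tailBound
  exact (((measurable_negExp.comp (measurable_id.const_mul _)).ennreal_toReal.const_sub 1).pow_const
    _).const_sub 1

lemma toReal_negExp_le_one (x : ℝ≥0∞) : (negExp x).toReal ≤ 1 := by
  simpa using ENNReal.toReal_mono ENNReal.one_ne_top (negExp_le_one x)

lemma tailBound_nonneg (j : LinkState) (r : ℝ) (Y : ℝ≥0∞) : 0 ≤ net.tailBound j r Y := by
  have h1 := toReal_negExp_le_one (ENNReal.ofReal (net.a j * net.fadingThreshold j r) * Y)
  have h2 : 0 ≤ (negExp (ENNReal.ofReal (net.a j * net.fadingThreshold j r) * Y)).toReal :=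
    ENNReal.toReal_nonneg
  rw [tailBound, sub_nonneg]
  exact pow_le_one₀ (by linarith) (by linarith)

/-- Dividing by the gain, positive for `r > 0`, turns the event into a gamma tail at
`fadingThreshold` times `Y`, where Alzer's bound applies; `Y = ∞` is allowed. -/
lemma fadingLaw_exceeds_le (j : LinkState) {r : ℝ} (hr : 0 < r) (Y : ℝ≥0∞) :
    net.fadingLaw j {g | ENNReal.ofReal net.Te * Y <
      ENNReal.ofReal (net.phi * net.Pt * net.Ms * (net.pathGain j r * g))} ≤
      ENNReal.ofReal (net.tailBound j r Y) := by
  have hTe := net.Te_pos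
  have hc : 0 < net.phi * net.Pt * net.Ms * net.pathGain j r := by
    have := net.phi_pos
    have := net.Pt_pos
    have := net.Ms_pos
    have := net.intercept_pos j
    have := Real.rpow_pos_of_pos hr (-net.alpha j)
    unfold pathGain
    positivity
  set c := net.phi * net.Pt * net.Ms * net.pathGain j r with hc_def
  have hset : {g | ENNReal.ofReal net.Te * Y <
      ENNReal.ofReal (net.phi * net.Pt * net.Ms * (net.pathGain j r * g))} =
      {g | ENNReal.ofReal (net.fadingThreshold j r) * Y < ENNReal.ofReal g} := by
    ext g
    have e1 : net.Te = c * net.fadingThreshold j r := by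
      have := net.phi_pos
      have := net.Pt_pos
      have := net.Ms_pos
      have := net.intercept_pos j
      have := Real.rpow_pos_of_pos hr (net.alpha j)
      rw [hc_def, pathGain, fadingThreshold, Real.rpow_neg hr.le]
      field_simp
    have e2 : net.phi * net.Pt * net.Ms * (net.pathGain j r * g) = c * g := by rw [hc_def]; ring
    simp only [mem_ofPred_eq]
    rw [e2, e1, ENNReal.ofReal_mul hc.le, ENNReal.ofReal_mul hc.le, mul_assoc]
    exact ENNReal.mul_lt_mul_iff_right (ENNReal.ofReal_pos.mpr hc).ne' ENNReal.ofReal_ne_top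
  rw [hset, tailBound, ENNReal.ofReal_mul (net.a_pos j).le, mul_assoc]
  exact gammaMeasure_lt_ofReal_le (net.shape j).pos (net.a_pos j) (net.a_pow_mul_factorial j) _

lemma measurableSet_sinr_le (x : Plane) {α : Type*} [MeasurableSpace α] {n : α → ℕ∞}
    {y : ℕ → α → Plane} {z : α → Plane} (hn : Measurable n)
    (hy : ∀ i, Measurable (y i)) (hz : Measurable z) :
    MeasurableSet {p : α × (LinkMark × (ℕ → LinkMark)) |
      net.sinr x (n p.1) (fun i => y i p.1) (z p.1) p.2 ≤ ENNReal.ofReal net.Te} := by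
  have h1 : Measurable fun p : α × (LinkMark × (ℕ → LinkMark)) =>
      net.noiseInterference (n p.1) (fun i => y i p.1) (z p.1) p.2.2 :=
    net.measurable_noiseInterference (y := fun i (p : α × (LinkMark × (ℕ → LinkMark))) => y i p.1)
      (w := fun i (p : α × (LinkMark × (ℕ → LinkMark))) => p.2.2 i) (hn.comp measurable_fst)
      (fun i => (hy i).comp measurable_fst) (hz.comp measurable_fst)
      fun i => (measurable_pi_apply i).comp (measurable_snd.comp measurable_snd)
  have h2 : Measurable fun p : α × (LinkMark × (ℕ → LinkMark)) =>
      net.linkGain (dist x (z p.1)) p.2.1 :=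
    net.measurable_linkGain.comp ((measurable_const.dist (hz.comp measurable_fst)).prodMk
      (measurable_fst.comp measurable_snd))
  exact measurableSet_le ((ENNReal.measurable_ofReal.comp (h2.const_mul _)).div
    (h1.add_const _)) measurable_const

lemma ofReal_probSinrLe (x : Plane) (n : ℕ∞) (y : ℕ → Plane) (z : Plane) :
    ENNReal.ofReal (net.probSinrLe x n y z) =
      (net.linkLaw.prod (Measure.infinitePi fun _ : ℕ => net.linkLaw))
        {w | net.sinr x n y z w ≤ ENNReal.ofReal net.Te} :=
  ofReal_measureReal

lemma measurable_probSinrLe (x : Plane) {α : Type*} [MeasurableSpace α] {n : α → ℕ∞}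
    {y : ℕ → α → Plane} {z : α → Plane} (hn : Measurable n)
    (hy : ∀ i, Measurable (y i)) (hz : Measurable z) :
    Measurable fun b => ENNReal.ofReal (net.probSinrLe x (n b) (fun i => y i b) (z b)) := by
  simp only [ofReal_probSinrLe]
  exact measurable_measure_prodMk_left (net.measurableSet_sinr_le x hn hy hz)

/-- The conditional probability of exceeding the threshold, bounded by averages over the
interference. -/
lemma one_sub_probSinrLe_le (x : Plane) (n : ℕ∞) (y : ℕ → Plane) (z : Plane) (hxz : 0 < dist x z) :
    1 - ENNReal.ofReal (net.probSinrLe x n y z) ≤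
      ∫⁻ w, (ENNReal.ofReal (net.qL (dist x z)) * ENNReal.ofReal (net.tailBound .LOS (dist x z)
          (net.noiseInterference n y z w + ENNReal.ofReal net.N0)) +
        ENNReal.ofReal (1 - net.qL (dist x z)) * ENNReal.ofReal (net.tailBound .NLOS (dist x z)
          (net.noiseInterference n y z w + ENNReal.ofReal net.N0)))
        ∂(Measure.infinitePi fun _ : ℕ => net.linkLaw) := by
  have hS : MeasurableSet {w | net.sinr x n y z w ≤ ENNReal.ofReal net.Te} :=
    (measurable_prodMk_left (x := ())) (net.measurableSet_sinr_le x (α := Unit) (n := fun _ => n)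
      (y := fun i _ => y i) (z := fun _ => z) measurable_const (fun _ => measurable_const)
      measurable_const)
  -- The marks of the interfering links are fixed and the serving link is integrated first.
  rw [ofReal_probSinrLe, ← prob_compl_eq_one_sub hS, Measure.prod_apply_symm hS.compl]
  refine lintegral_mono fun w => ?_
  set Y := net.noiseInterference n y z w + ENNReal.ofReal net.N0 with hY
  have hN0 : ENNReal.ofReal net.N0 ≠ 0 := (ENNReal.ofReal_pos.mpr net.N0_pos).ne'
  have hY0 : Y ≠ 0 := fun h => hN0 (add_eq_zero.mp h).2
  have hTe0 : ENNReal.ofReal net.Te ≠ 0 := (ENNReal.ofReal_pos.mpr net.Te_pos).ne'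
  set r := dist x z with hr
  have hm : ∀ j, MeasurableSet {g : ℝ | ENNReal.ofReal net.Te * Y <
      ENNReal.ofReal (net.phi * net.Pt * net.Ms * (net.pathGain j r * g))} := fun j =>
    measurableSet_lt measurable_const (by fun_prop)
  have hset : (fun m => (m, w)) ⁻¹' {w | net.sinr x n y z w ≤ ENNReal.ofReal net.Te}ᶜ =
      {m | ENNReal.ofReal net.Te * Y <
        ENNReal.ofReal (net.phi * net.Pt * net.Ms * net.linkGain r m)} := by
    ext m
    simp only [mem_preimage, mem_compl_iff, mem_ofPred_eq, sinr, ← hY, ← hr]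
    rw [ENNReal.div_le_iff_le_mul (Or.inl hY0) (Or.inr hTe0), not_le]
  have hmeas : MeasurableSet {m | ENNReal.ofReal net.Te * Y <
        ENNReal.ofReal (net.phi * net.Pt * net.Ms * net.linkGain r m)} :=
    measurableSet_lt measurable_const (ENNReal.measurable_ofReal.comp
      ((net.measurable_linkGain.comp measurable_prodMk_left).const_mul _))
  rw [hset, ← lintegral_indicator_one hmeas]
  have hite : ∀ m : LinkMark, {m | ENNReal.ofReal net.Te * Y <
        ENNReal.ofReal (net.phi * net.Pt * net.Ms * net.linkGain r m)}.indicator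
          (1 : LinkMark → ℝ≥0∞) m =
      if m.1 ≤ net.qL r then {g : ℝ | ENNReal.ofReal net.Te * Y < ENNReal.ofReal
          (net.phi * net.Pt * net.Ms * (net.pathGain .LOS r * g))}.indicator 1 m.2.1
        else {g : ℝ | ENNReal.ofReal net.Te * Y < ENNReal.ofReal
          (net.phi * net.Pt * net.Ms * (net.pathGain .NLOS r * g))}.indicator 1 m.2.2 := by
    intro m
    unfold linkGain
    split_ifs with h <;> simp [indicator, h]
  simp only [hite]
  rw [net.lintegral_linkLaw_ite (net.qL_nonneg r) (net.qL_le_one r)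
    (measurable_one.indicator (hm .LOS)) (measurable_one.indicator (hm .NLOS)),
    lintegral_indicator_one (hm .LOS), lintegral_indicator_one (hm .NLOS)]
  gcongr
  · exact net.fadingLaw_exceeds_le .LOS hxz Y
  · exact net.fadingLaw_exceeds_le .NLOS hxz Y

/-- `Omega` is the average of the exponential tail bound. -/
lemma lintegral_tailBound {Ω : Type*} [MeasurableSpace Ω] {P : Measure Ω}
    [IsProbabilityMeasure P] {ΦA : PointProcess Ω Plane}
    (hA : ΦA.IsPoisson (ENNReal.ofReal (net.lamB * net.probMa) • volume) P) (j : LinkState)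
    {r : ℝ} (hr : 0 ≤ r) (z : Plane) :
    ∫⁻ ω, ∫⁻ w, ENNReal.ofReal (net.tailBound j r
        (net.noiseInterference (ΦA.count ω) (fun k => ΦA.point k ω) z w + ENNReal.ofReal net.N0))
        ∂(Measure.infinitePi fun _ : ℕ => net.linkLaw) ∂P =
      ENNReal.ofReal (net.Omega j r) ∧ 0 ≤ net.Omega j r := by
  set Q := P.prod (Measure.infinitePi fun _ : ℕ => net.linkLaw) with hQ
  set Y : Ω × (ℕ → LinkMark) → ℝ≥0∞ := fun p =>
    net.noiseInterference (ΦA.count p.1) (fun k => ΦA.point k p.1) z p.2 + ENNReal.ofReal net.N0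
    with hYdef
  have hI : Measurable fun p : Ω × (ℕ → LinkMark) =>
      net.noiseInterference (ΦA.count p.1) (fun k => ΦA.point k p.1) z p.2 :=
    net.measurable_noiseInterference (y := fun i (p : Ω × (ℕ → LinkMark)) => ΦA.point i p.1)
      (w := fun i (p : Ω × (ℕ → LinkMark)) => p.2 i)
      (ΦA.measurable_count.comp measurable_fst)
      (fun i => (ΦA.measurable_point i).comp measurable_fst) measurable_const
      fun i => (measurable_pi_apply i).comp measurable_snd
  have hY : Measurable Y := hI.add_const _
  set t := net.a j * net.fadingThreshold j r with ht_def
  have ht : 0 ≤ t := mul_nonneg (net.a_pos j).le (net.fadingThreshold_nonneg j hr)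
  have hN0 := net.N0_pos
  -- The `n`-th power of `e^{-tY}` is `e^{-ntY}`, so its mean is the Laplace transform of `Y` at `n
  -- * t`, with the constant noise as a separate factor.
  have hmoment : ∀ n : ℕ, ∫ p, (negExp (ENNReal.ofReal t * Y p)).toReal ^ n ∂Q =
      Real.exp (-(n * t * net.N0)) * Real.exp (net.Psi ((1 - net.phi) * net.Pt * (n * t))) := by
    intro n
    have hnt : 0 ≤ (n : ℝ) * t := by positivity
    have e1 : ∀ p, (negExp (ENNReal.ofReal t * Y p)).toReal ^ n =
        (negExp (ENNReal.ofReal (n * t) * net.noiseInterference (ΦA.count p.1)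
          (fun k => ΦA.point k p.1) z p.2) * ENNReal.ofReal (Real.exp (-(n * t * net.N0)))).toReal := by
      intro p
      rw [← ENNReal.toReal_pow, ← negExp_nat_mul, ← mul_assoc,
        ENNReal.ofReal_mul (Nat.cast_nonneg n), ENNReal.ofReal_natCast, hYdef, mul_add, negExp_add]
      congr 2
      rw [← ENNReal.ofReal_natCast, ← ENNReal.ofReal_mul (by positivity),
        ← ENNReal.ofReal_mul (by positivity), negExp_ofReal (by positivity)]
    have hm : Measurable fun p : Ω × (ℕ → LinkMark) => negExp (ENNReal.ofReal (n * t) *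
        net.noiseInterference (ΦA.count p.1) (fun k => ΦA.point k p.1) z p.2) :=
      measurable_negExp.comp (hI.const_mul _)
    simp only [e1]
    rw [integral_toReal (hm.mul_const _).aemeasurable (ae_of_all _ fun p =>
      ENNReal.mul_lt_top (negExp_ne_top _).lt_top ENNReal.ofReal_lt_top),
      lintegral_mul_const _ hm, hQ, lintegral_prod _ hm.aemeasurable,
      net.lintegral_negExp_noiseInterference hA hnt z, ENNReal.toReal_mul,
      ENNReal.toReal_ofReal (Real.exp_nonneg _), ENNReal.toReal_ofReal (Real.exp_nonneg _), mul_comm]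
  have hZm : Measurable fun p => (negExp (ENNReal.ofReal t * Y p)).toReal :=
    (measurable_negExp.comp (hY.const_mul _)).ennreal_toReal
  have hZint : ∀ n : ℕ, Integrable (fun p => (negExp (ENNReal.ofReal t * Y p)).toReal ^ n) Q := by
    intro n
    refine Integrable.of_bound (hZm.pow_const n).aestronglyMeasurable 1 (ae_of_all _ fun p => ?_)
    rw [Real.norm_of_nonneg (pow_nonneg ENNReal.toReal_nonneg n)]
    exact pow_le_one₀ ENNReal.toReal_nonneg (toReal_negExp_le_one _)
  -- The binomial signs alternate, hence the real integrals here. The nonnegativity of `Omega`, not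
  -- visible from its formula, follows since it is the mean of a nonnegative quantity.
  have hexpand : ∀ p, net.tailBound j r (Y p) = ∑ n ∈ Finset.Icc 1 (net.shape j : ℕ),
      (-1 : ℝ) ^ (n + 1) * ((net.shape j : ℕ).choose n : ℝ) *
        (negExp (ENNReal.ofReal t * Y p)).toReal ^ n := fun p => by
    rw [tailBound, one_sub_one_sub_pow]
  have hint : Integrable (fun p => net.tailBound j r (Y p)) Q := by
    simp only [hexpand]
    exact integrable_finsetSum _ fun n _ => (hZint n).const_mul _
  have hval : ∫ p, net.tailBound j r (Y p) ∂Q = net.Omega j r := by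
    simp only [hexpand]
    rw [integral_finsetSum _ fun n _ => (hZint n).const_mul _, Omega]
    refine Finset.sum_congr rfl fun n _ => ?_
    have hP := net.Pt_pos.ne'
    rw [integral_const_mul, hmoment, ← mul_assoc]
    congr 3
    · rw [ht_def, fadingThreshold]; congr 1; ring
    · rw [ht_def, fadingThreshold]
      have := net.phi_pos.ne'
      have := net.Ms_pos.ne'
      have := (net.intercept_pos j).ne'
      field_simp
  have hnn : ∀ p, 0 ≤ net.tailBound j r (Y p) := fun p => net.tailBound_nonneg j r _
  refine ⟨?_, hval ▸ integral_nonneg hnn⟩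
  have hmeas : Measurable fun p => ENNReal.ofReal (net.tailBound j r (Y p)) :=
    ENNReal.measurable_ofReal.comp ((net.measurable_tailBound j r).comp hY)
  rw [← hval, ofReal_integral_eq_lintegral_ofReal hint (ae_of_all _ hnn), hQ,
    lintegral_prod _ hmeas.aemeasurable]

end MmWave.Network

/-! ### Integrability of `Omega`, conditioning on `ΦA` and the final bound -/

namespace MmWave

lemma PointProcess.measurable_listing {Ω E : Type*} [MeasurableSpace Ω] [MeasurableSpace E]
    (Φ : PointProcess Ω E) : Measurable Φ.listing :=
  Φ.measurable_count.prodMk (measurable_pi_lambda _ Φ.measurable_point)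

/-- The Laplace functional of a Poisson point process, for a function that depends on an
independent random element. -/
lemma PointProcess.IsPoisson.lintegral_negExp_of_indepFun {Ω E α : Type*} [MeasurableSpace Ω]
    [MeasurableSpace E] [MeasurableSpace α] {Φ : PointProcess Ω E} {Λ : Measure E} [SigmaFinite Λ]
    {P : Measure Ω} [IsProbabilityMeasure P] (hΦ : Φ.IsPoisson Λ P) {A : Ω → α}
    (hA : Measurable A) (hind : IndepFun A Φ.listing P) {H : α → E → ℝ≥0∞}
    (hH : Measurable (Function.uncurry H)) :
    ∫⁻ ω, negExp (listSum (H (A ω)) (Φ.count ω) fun i => Φ.point i ω) ∂P =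
      ∫⁻ ω, negExp (∫⁻ z, (1 - negExp (H (A ω) z)) ∂Λ) ∂P := by
  have hF : Measurable fun p : α × (ℕ∞ × (ℕ → E)) => negExp (listSum (H p.1) p.2.1 p.2.2) :=
    measurable_negExp.comp (measurable_listSum (h := fun p : α × (ℕ∞ × (ℕ → E)) => H p.1)
      (y := fun i (p : α × (ℕ∞ × (ℕ → E))) => p.2.2 i)
      (hH.comp ((measurable_fst.comp measurable_fst).prodMk measurable_snd))
      (measurable_fst.comp measurable_snd)
      fun i => (measurable_pi_apply i).comp (measurable_snd.comp measurable_snd))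
  have hZ := Φ.measurable_listing
  have hjoint := (indepFun_iff_map_prod_eq_prod_map_map hA.aemeasurable hZ.aemeasurable).mp hind
  have := Measure.isProbabilityMeasure_map (μ := P) hZ.aemeasurable
  calc ∫⁻ ω, negExp (listSum (H (A ω)) (Φ.count ω) fun i => Φ.point i ω) ∂P
      = ∫⁻ p, negExp (listSum (H p.1) p.2.1 p.2.2) ∂(P.map fun ω => (A ω, Φ.listing ω)) :=
        (lintegral_map hF (hA.prodMk hZ)).symm
    _ = ∫⁻ ω, ∫⁻ l, negExp (listSum (H (A ω)) l.1 l.2) ∂(P.map Φ.listing) ∂P := by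
        rw [hjoint, lintegral_prod _ hF.aemeasurable, lintegral_map hF.lintegral_prod_right' hA]
    _ = _ := by
        refine lintegral_congr fun ω => ?_
        have hHω : Measurable (H (A ω)) := hH.comp measurable_prodMk_left
        rw [← hΦ.lintegral_negExp hHω]
        exact lintegral_map (f := fun l : ℕ∞ × (ℕ → E) => negExp (listSum (H (A ω)) l.1 l.2))
          (hF.comp measurable_prodMk_left) hZ

namespace Network

variable (net : Network)

/-- Since `Psi ≤ 0`, each term is at most a binomial coefficient times `e^{-b r^α}`, and `b > 0`
because the noise power is positive. -/
lemma integrableOn_Omega (j : LinkState) :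
    IntegrableOn (fun r => net.Omega j r * r) (Ioi 0) := by
  obtain ⟨f, hf, hPsi⟩ := net.exists_measurable_eq_Psi
  have h1phi : 0 ≤ 1 - net.phi := sub_nonneg.mpr net.phi_le_one
  have := net.phi_pos
  have := net.Ms_pos
  have := net.Pt_pos
  have := net.Te_pos
  have := net.N0_pos
  have := net.a_pos j
  have hCj := net.intercept_pos j
  have hterm : ∀ n ∈ Finset.Icc 1 (net.shape j : ℕ), IntegrableOn (fun r =>
      (-1 : ℝ) ^ (n + 1) * ((net.shape j : ℕ).choose n : ℝ) *
      Real.exp (-((n : ℝ) * net.a j * net.Te * r ^ net.alpha j * net.N0 /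
        (net.phi * net.Pt * net.Ms * net.intercept j))) *
      Real.exp (net.Psi ((1 - net.phi) * (n : ℝ) * net.a j * net.Te * r ^ net.alpha j /
        (net.phi * net.Ms * net.intercept j))) * r) (Ioi 0) := by
    intro n hn
    have hn0 : (0 : ℝ) < n := Nat.cast_pos.mpr (Finset.mem_Icc.mp hn).1
    set b := (n : ℝ) * net.a j * net.Te * net.N0 / (net.phi * net.Pt * net.Ms * net.intercept j)
      with hb_def
    have hb : 0 < b := by positivity
    have harg : ∀ r ∈ Ioi (0 : ℝ), 0 ≤ (1 - net.phi) * (n : ℝ) * net.a j * net.Te * r ^ net.alpha j /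
        (net.phi * net.Ms * net.intercept j) := by
      intro r hr
      have := Real.rpow_pos_of_pos hr (net.alpha j)
      positivity
    have hdom := (integrableOn_rpow_mul_exp_neg_mul_rpow (s := 1) (by norm_num) (net.alpha_pos j)
      hb).const_mul ((net.shape j : ℕ).choose n : ℝ)
    refine Integrable.mono' hdom ?_ ?_
    · have hm : Measurable fun r : ℝ => (-1 : ℝ) ^ (n + 1) * ((net.shape j : ℕ).choose n : ℝ) *
          Real.exp (-((n : ℝ) * net.a j * net.Te * r ^ net.alpha j * net.N0 /
            (net.phi * net.Pt * net.Ms * net.intercept j))) *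
          Real.exp (f ((1 - net.phi) * (n : ℝ) * net.a j * net.Te * r ^ net.alpha j /
            (net.phi * net.Ms * net.intercept j))) * r := by fun_prop
      refine hm.aestronglyMeasurable.congr ?_
      filter_upwards [ae_restrict_mem measurableSet_Ioi] with r hr
      rw [hPsi _ (harg r hr)]
    · filter_upwards [ae_restrict_mem measurableSet_Ioi] with r hr
      have hr0 : (0 : ℝ) < r := hr
      have h1 := Real.exp_le_one_iff.mpr (net.Psi_nonpos (harg r hr))
      have h2 : Real.exp (-((n : ℝ) * net.a j * net.Te * r ^ net.alpha j * net.N0 /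
        (net.phi * net.Pt * net.Ms * net.intercept j))) = Real.exp (-b * r ^ net.alpha j) := by
        rw [hb_def]; congr 1; ring
      rw [h2, norm_mul, norm_mul, norm_mul, norm_mul, norm_pow, norm_neg, norm_one, one_pow, one_mul,
        Real.norm_natCast, Real.norm_of_nonneg (Real.exp_nonneg _),
        Real.norm_of_nonneg (Real.exp_nonneg _), Real.norm_of_nonneg hr0.le, Real.rpow_one]
      calc _ ≤ ((net.shape j : ℕ).choose n : ℝ) * Real.exp (-b * r ^ net.alpha j) * 1 * r := by
            gcongr
        _ = _ := by ring
  have := integrable_finsetSum (Finset.Icc 1 (net.shape j : ℕ)) hterm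
  refine this.congr (ae_of_all _ fun r => ?_)
  simp only [Omega, Finset.sum_mul]

lemma lintegral_lintegral_const_mul_add {α β : Type*} [MeasurableSpace α] [MeasurableSpace β]
    (μ : Measure α) (ν : Measure β) [SFinite ν] {F G : α → β → ℝ≥0∞}
    (hF : Measurable (Function.uncurry F)) (hG : Measurable (Function.uncurry G)) (c d : ℝ≥0∞) :
    ∫⁻ x, ∫⁻ y, (c * F x y + d * G x y) ∂ν ∂μ =
      c * ∫⁻ x, ∫⁻ y, F x y ∂ν ∂μ + d * ∫⁻ x, ∫⁻ y, G x y ∂ν ∂μ := by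
  have hF' : Measurable fun x => ∫⁻ y, F x y ∂ν := hF.lintegral_prod_right'
  have hG' : Measurable fun x => ∫⁻ y, G x y ∂ν := hG.lintegral_prod_right'
  rw [← lintegral_const_mul _ hF', ← lintegral_const_mul _ hG',
    ← lintegral_add_left (hF'.const_mul _)]
  refine lintegral_congr fun x => ?_
  have h1 : Measurable (F x) := hF.comp measurable_prodMk_left
  have h2 : Measurable (G x) := hG.comp measurable_prodMk_left
  rw [lintegral_add_left (h1.const_mul _), lintegral_const_mul _ h1, lintegral_const_mul _ h2]

/-- The probability that an eavesdropper exceeds the threshold, bounded by `Omega`. -/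
lemma lintegral_one_sub_probSinrLe_le {Ω : Type*} [MeasurableSpace Ω] {P : Measure Ω}
    [IsProbabilityMeasure P] {ΦA : PointProcess Ω Plane}
    (hA : ΦA.IsPoisson (ENNReal.ofReal (net.lamB * net.probMa) • volume) P) (x z : Plane)
    (hxz : 0 < dist x z) :
    ∫⁻ ω, (1 - ENNReal.ofReal
        (net.probSinrLe x (ΦA.count ω) (fun k => ΦA.point k ω) z)) ∂P ≤
      ENNReal.ofReal (net.qL (dist x z) * net.Omega .LOS (dist x z) +
        (1 - net.qL (dist x z)) * net.Omega .NLOS (dist x z)) := by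
  set r := dist x z with hr
  have hq0 := net.qL_nonneg r
  have hq1 : 0 ≤ 1 - net.qL r := sub_nonneg.mpr (net.qL_le_one r)
  obtain ⟨hL, hL0⟩ := net.lintegral_tailBound hA .LOS hxz.le z
  obtain ⟨hN, hN0⟩ := net.lintegral_tailBound hA .NLOS hxz.le z
  have hI : Measurable fun p : Ω × (ℕ → LinkMark) =>
      net.noiseInterference (ΦA.count p.1) (fun k => ΦA.point k p.1) z p.2 :=
    net.measurable_noiseInterference (y := fun i (p : Ω × (ℕ → LinkMark)) => ΦA.point i p.1)
      (w := fun i (p : Ω × (ℕ → LinkMark)) => p.2 i)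
      (ΦA.measurable_count.comp measurable_fst)
      (fun i => (ΦA.measurable_point i).comp measurable_fst) measurable_const
      fun i => (measurable_pi_apply i).comp measurable_snd
  have hT : ∀ j, Measurable fun p : Ω × (ℕ → LinkMark) => ENNReal.ofReal (net.tailBound j r
      (net.noiseInterference (ΦA.count p.1) (fun k => ΦA.point k p.1) z p.2 +
        ENNReal.ofReal net.N0)) := fun j =>
    ENNReal.measurable_ofReal.comp ((net.measurable_tailBound j r).comp (hI.add_const _))
  refine (lintegral_mono fun ω => net.one_sub_probSinrLe_le x _ _ z hxz).trans_eq ?_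
  rw [ENNReal.ofReal_add (mul_nonneg hq0 hL0) (mul_nonneg hq1 hN0), ENNReal.ofReal_mul hq0,
    ENNReal.ofReal_mul hq1, ← hL, ← hN]
  exact lintegral_lintegral_const_mul_add P _ (hT .LOS) (hT .NLOS) _ _

/-- The secrecy probability as an iterated expectation over independent processes. -/
lemma secrecyProb_eq {Ω : Type*} [MeasurableSpace Ω] (P : Measure Ω)
    [IsProbabilityMeasure P] (ΦA ΦZ : PointProcess Ω Plane) {Λ : Measure Plane} [SigmaFinite Λ]
    (hZ : ΦZ.IsPoisson Λ P) (hAZ : IndepFun ΦA.listing ΦZ.listing P) (x : Plane) :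
    net.secrecyProb P ΦA ΦZ x = (∫⁻ ω, negExp (∫⁻ z, (1 - ENNReal.ofReal
        (net.probSinrLe x (ΦA.count ω) (fun k => ΦA.point k ω) z)) ∂Λ) ∂P).toReal := by
  -- With `H = -log p`, the product over eavesdroppers is `negExp` of a sum over `ΦZ`, including the
  -- case of a vanishing product.
  set H : (ℕ∞ × (ℕ → Plane)) → Plane → ℝ≥0∞ := fun A z =>
    negLog (ENNReal.ofReal (net.probSinrLe x A.1 A.2 z)) with hH
  have hHm : Measurable (Function.uncurry H) :=
    measurable_negLog.comp (net.measurable_probSinrLe x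
      (n := fun p : (ℕ∞ × (ℕ → Plane)) × Plane => p.1.1)
      (y := fun i (p : (ℕ∞ × (ℕ → Plane)) × Plane) => p.1.2 i) (z := fun p => p.2)
      (measurable_fst.comp measurable_fst)
      (fun i => (measurable_pi_apply i).comp (measurable_snd.comp measurable_fst)) measurable_snd)
  have hHexp : ∀ A z, negExp (H A z) = ENNReal.ofReal (net.probSinrLe x A.1 A.2 z) := by
    intro A z
    refine negExp_negLog ?_
    rw [ofReal_probSinrLe]
    exact prob_le_one
  have hp0 : ∀ A : ℕ∞ × (ℕ → Plane), ∀ z, 0 ≤ net.probSinrLe x A.1 A.2 z := fun A z =>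
    measureReal_nonneg
  have hprod : ∀ ω, (∏' i : ℕ, (if (i : ℕ∞) < ΦZ.count ω then
      net.probSinrLe x (ΦA.count ω) (fun k => ΦA.point k ω) (ΦZ.point i ω) else 1)) =
      (negExp (listSum (H (ΦA.listing ω)) (ΦZ.count ω) fun i => ΦZ.point i ω)).toReal := by
    intro ω
    refine HasProd.tprod_eq ?_
    have h := (ENNReal.tendsto_toReal (negExp_ne_top _)).comp (tendsto_prod_negExp fun i : ℕ =>
      if (i : ℕ∞) < ΦZ.count ω then H (ΦA.listing ω) (ΦZ.point i ω) else 0)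
    refine Filter.Tendsto.congr (fun s => ?_) h
    rw [Function.comp_apply, ENNReal.toReal_prod]
    refine Finset.prod_congr rfl fun i _ => ?_
    dsimp only
    split_ifs
    · rw [hHexp, ENNReal.toReal_ofReal (hp0 _ _), PointProcess.listing]
    · simp
  have hAm : Measurable fun p : Ω × Plane => (ΦA.listing p.1, p.2) :=
    (ΦA.measurable_listing.comp measurable_fst).prodMk measurable_snd
  clear_value H
  have hm : Measurable fun ω =>
      negExp (listSum (H (ΦA.listing ω)) (ΦZ.count ω) fun i => ΦZ.point i ω) :=
    measurable_negExp.comp (measurable_listSum (h := fun ω => H (ΦA.listing ω)) (hHm.comp hAm)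
      (n := ΦZ.count) ΦZ.measurable_count (y := ΦZ.point) ΦZ.measurable_point)
  rw [secrecyProb]
  simp only [hprod]
  rw [integral_toReal hm.aemeasurable (ae_of_all _ fun ω => (negExp_ne_top _).lt_top),
    hZ.lintegral_negExp_of_indepFun ΦA.measurable_listing hAZ hHm]
  simp only [hHexp, PointProcess.listing]

end Network

end MmWave

theorem theorem7 (net : MmWave.Network) {Ω : Type*} [MeasurableSpace Ω] (P : Measure Ω)
    [IsProbabilityMeasure P]
    (ΦA ΦZ : MmWave.PointProcess Ω MmWave.Plane)
    (hA : ΦA.IsPoisson (ENNReal.ofReal (net.lamB * net.probMa) • volume) P)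
    (hZ : ΦZ.IsPoisson (ENNReal.ofReal (net.lamE * net.probMs) • volume) P)
    (hAZ : IndepFun ΦA.listing ΦZ.listing P)
    (x : MmWave.Plane) :
    IntervalIntegrable (fun r => net.Omega .LOS r * r) volume 0 net.D ∧
    IntervalIntegrable (fun r => net.Omega .NLOS r * r) volume 0 net.D ∧
    IntegrableOn (fun r => net.Omega .NLOS r * r) (Ioi net.D) volume ∧
    Real.exp (-2 * Real.pi * net.C * net.lamE * net.probMs *
          (∫ r in (0 : ℝ)..net.D, net.Omega .LOS r * r) -
        2 * Real.pi * (1 - net.C) * net.lamE * net.probMs *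
          (∫ r in (0 : ℝ)..net.D, net.Omega .NLOS r * r)) *
      Real.exp (-2 * Real.pi * net.lamE * net.probMs *
          (∫ r in Ioi net.D, net.Omega .NLOS r * r)) ≤
      net.secrecyProb P ΦA ΦZ x := by
  have hD := net.D_pos
  have hin : ∀ j, IntervalIntegrable (fun r => net.Omega j r * r) volume 0 net.D := fun j =>
    (intervalIntegrable_iff_integrableOn_Ioc_of_le hD.le).mpr
      ((net.integrableOn_Omega j).mono_set Ioc_subset_Ioi_self)
  have hout : IntegrableOn (fun r => net.Omega .NLOS r * r) (Ioi net.D) :=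
    (net.integrableOn_Omega .NLOS).mono_set (Ioi_subset_Ioi hD.le)
  refine ⟨hin .LOS, hin .NLOS, hout, ?_⟩
  obtain ⟨hmix, hval⟩ := net.integral_mixture (hin .LOS) (hin .NLOS) hout
  set f : ℝ → ℝ := fun r => net.qL r * net.Omega .LOS r + (1 - net.qL r) * net.Omega .NLOS r
    with hf
  have hf0 : ∀ r, 0 < r → 0 ≤ f r := fun r hr =>
    add_nonneg (mul_nonneg (net.qL_nonneg r) (net.lintegral_tailBound hA .LOS hr.le x).2)
      (mul_nonneg (sub_nonneg.mpr (net.qL_le_one r))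
        (net.lintegral_tailBound hA .NLOS hr.le x).2)
  have hlam : 0 ≤ net.lamE * net.probMs := mul_nonneg net.lamE_nonneg net.probMs_nonneg
  -- The bound on the mean number of eavesdroppers exceeding the threshold; `exp (-M)` is the left
  -- side of the claim.
  set M : ℝ := net.lamE * net.probMs * (2 * Real.pi * ∫ r in Ioi (0 : ℝ), f r * r) with hM_def
  have hM : 0 ≤ M := by
    have : 0 ≤ ∫ r in Ioi (0 : ℝ), f r * r :=
      setIntegral_nonneg measurableSet_Ioi fun r hr => mul_nonneg (hf0 r hr) (le_of_lt hr)
    positivity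
  have := sigmaFinite_ofReal_smul (net.lamE * net.probMs) (volume : Measure MmWave.Plane)
  have hmeas : Measurable fun p : Ω × MmWave.Plane => 1 - ENNReal.ofReal
      (net.probSinrLe x (ΦA.count p.1) (fun k => ΦA.point k p.1) p.2) :=
    (net.measurable_probSinrLe x (n := fun p : Ω × MmWave.Plane => ΦA.count p.1)
      (y := fun i (p : Ω × MmWave.Plane) => ΦA.point i p.1) (z := fun p => p.2)
      (ΦA.measurable_count.comp measurable_fst)
      (fun i => (ΦA.measurable_point i).comp measurable_fst) measurable_snd).const_sub 1
  have hmean : ∫⁻ ω, ∫⁻ z, (1 - ENNReal.ofReal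
      (net.probSinrLe x (ΦA.count ω) (fun k => ΦA.point k ω) z))
        ∂(ENNReal.ofReal (net.lamE * net.probMs) • volume) ∂P ≤ ENNReal.ofReal M := by
    -- Tonelli's theorem: the average over `ΦA` is taken at each fixed `z`, where the bound by
    -- `Omega` is available.
    rw [lintegral_lintegral_swap hmeas.aemeasurable, lintegral_smul_measure, hM_def,
      ENNReal.ofReal_mul hlam, ← lintegral_plane_dist hmix hf0 x, smul_eq_mul]
    gcongr 1
    refine lintegral_mono_ae ?_
    -- The pointwise bound assumes a positive distance from the serving station; the excluded point
    -- is a null set.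
    filter_upwards [Measure.ae_ne volume x] with z hz
    rw [dist_comm z x]
    exact net.lintegral_one_sub_probSinrLe_le hA x z (dist_pos.mpr hz.symm)
  have hJ := negExp_le_lintegral_negExp P (hmeas.lintegral_prod_right'
    (ν := ENNReal.ofReal (net.lamE * net.probMs) • volume)) hM hmean
  rw [net.secrecyProb_eq P ΦA ΦZ hZ hAZ x, ← Real.exp_add]
  refine le_trans (le_of_eq ?_) ((ENNReal.ofReal_le_iff_le_toReal ?_).mp hJ)
  · rw [hM_def, hval]
    congr 1
    ring
  · exact ((lintegral_mono fun ω => negExp_le_one _).trans (by simp)).trans_lt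
      ENNReal.one_lt_top |>.ne
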